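/- **Setting.** Let $f\colon\mathbb R\to\mathbb R$ be Lipschitz with $f(0)=0$ and differentiable at $0$. Put $a(u)=f(u)/u$ for $u\neq 0$ and $a(0)=f'(0)$, and for $v_l,v_r\ge 0$ let $$V(v_l,v_r)=\min_{[v_l,v_r]}a\ \text{ if } v_l\le v_r,\qquad V(v_l,v_r)=\max_{[v_r,v_l]}a\ \text{ if } v_r\le v_l .$$ Let $u_0\in \mathrm{BV}\cap L^1(\mathbb R)$ be nonnegative, $T>0$, $N\ge 1$, and let $x_0^1<\dots<x_0^N$ be real numbers. Set $v_0^i=\frac1{x_0^{i+1}-x_0^i}\int_{x_0^i}^{x_0^{i+1}}u_0\,dx$ for $1\le i<N$, $v_0^0=v_0^N=0$, and $v_0=\sum_{i=1}^{N-1}v_0^i\chi_{(x_0^i,x_0^{i+1})}$. **The particle path scheme.** A run of the scheme on $[0,T]$ consists of times $0=t_0<t_1<\dots<t_{m+1}=T$ and, on each $[t_j,t_{j+1}]$ ($0\le j\le m$), of $N_j$ particles $x^1,\dots,x^{N_j}$, continuous on $[t_j,t_{j+1}]$ with $x^1_t<\dots<x^{N_j}_t$ for $t_j\le t<t_{j+1}$,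 and local densities $v^i$ with $v^0_t=v^{N_j}_t=0$, such that $$\dot x^i_t=V(v_t^{i-1},v_t^i)\quad(t_j<t<t_{j+1},\ 1\le i\le N_j),\qquad v_t^i=\frac{x^{i+1}_{t_j}-x^i_{t_j}}{x^{i+1}_t-x^i_t}\,v^i_{t_j}\quad(1\le i<N_j).$$ At $t_0=0$ there are the $N_0=N$ particles $x_0^i$ with densities $v_0^i$. For each $0\le j<m$, $t_{j+1}$ is a collision time, i.e. $x^i_{t_{j+1}}=x^{i+1}_{t_{j+1}}$ for some $1\le i<N_j$. There, all particles $i<N_j$ with $x^i_{t_{j+1}}=x^{i+1}_{t_{j+1}}$ are deleted together with their densities $v^i$, the remaining particles and densities are relabelled increasingly, and the system is restarted from their values at $t_{j+1}$. For $t\in[t_j,t_{j+1})$, and for $t=T$ with $j=m$, define $$v(x,t)=\sum_{i=1}^{N_j-1}v_t^i\,\chi_{(x_t^i,x_t^{i+1})}(x),$$ and let $A(\cdot,t)$ be the piecewise linear interpolation of the particle velocities $V(v_t^{i-1},v_t^i)$ at the nodes $x_t^i$, extended by constants to the left of $x^1_t$ and to the right of $x^{N_j}_t$. **Theorem.** Let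 $v$ and $A$ come from a run of the scheme on $[0,T]$. Then for every constant $k\ge0$ and every nonnegative $\varphi\in C_c^\infty(\mathbb R\times[0,T])$ (the restriction to $\mathbb R\times[0,T]$ of a function in $C_c^\infty(\mathbb R^2)$, nonnegative on $\mathbb R\times[0,T]$), the following integrands are integrable and $$\int_0^T\!\!\int_{\mathbb R}\Bigl(|v-k|\,\partial_t\varphi+(Av-f(k))\,\mathrm{sgn}(v-k)\,\partial_x\varphi\Bigr)dx\,dt-\int_{\mathbb R}\varphi(x,T)\,|v(x,T)-k|\,dx+\int_{\mathbb R}\varphi(x,0)\,|v_0(x)-k|\,dx\ \ge\ 0,$$ where $\mathrm{sgn}(0)=0$. -/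

import Mathlib

open Set MeasureTheory
open scoped NNReal ContDiff

noncomputable section

namespace ParticlePath

/-- The particle speed `a(u) = f(u) / u`, extended to `u = 0` by its limit `f'(0)`
(recall that `f 0 = 0`). -/
def speed (f : ℝ → ℝ) (u : ℝ) : ℝ :=
  if u = 0 then deriv f 0 else f u / u

/-- The entropic velocity `V(v_l, v_r)`: the minimum of `a` over `[v_l, v_r]` if `v_l ≤ v_r`, and
the maximum of `a` over `[v_r, v_l]` if `v_r ≤ v_l`. It is only used for nonnegative arguments,
where `a` is continuous, so that the extrema are attained. -/
def velocity (f : ℝ → ℝ) (l r : ℝ) : ℝ :=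
  if l ≤ r then sInf (speed f '' Icc l r) else sSup (speed f '' Icc r l)

/-- `u` is (almost everywhere equal to) a function of bounded variation on `ℝ`. -/
def IsBV (u : ℝ → ℝ) : Prop :=
  ∃ w : ℝ → ℝ, u =ᵐ[volume] w ∧ BoundedVariationOn w univ

/-- The initial local density `v_0^i`: the mean of `u₀` over `(y i, y (i + 1))`. -/
def initialLocalDensity (u₀ : ℝ → ℝ) (y : ℕ → ℝ) (i : ℕ) : ℝ :=
  1 / (y (i + 1) - y i) * ∫ z in (y i)..(y (i + 1)), u₀ z

/-- The initial approximation `v_0`, for `N` particles at `y 1 < ⋯ < y N`. The two unbounded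
outer cells have density zero. -/
def initialApprox (u₀ : ℝ → ℝ) (N : ℕ) (y : ℕ → ℝ) (z : ℝ) : ℝ :=
  ∑ i ∈ Finset.Ico 1 N,
    (Ioo (y i) (y (i + 1))).indicator (fun _ => initialLocalDensity u₀ y i) z

/-- The raw data of a run of the scheme with `m` collision times before the final time.
Stage `j` (for `0 ≤ j ≤ m`) is the time interval between `τ j` and `τ (j + 1)`. In stage `j`,
`n j` particles are present, labelled `1, …, n j` from left to right; particle `i` is at `x j i t`
at time `t`, and the cell between particles `i` and `i + 1` (`1 ≤ i < n j`) has density `w j i` at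
the beginning `τ j` of the stage. Values at other indices are irrelevant. -/
structure Run where
  m : ℕ
  τ : ℕ → ℝ
  n : ℕ → ℕ
  x : ℕ → ℕ → ℝ → ℝ
  w : ℕ → ℕ → ℝ

namespace Run

/-- The local density `v_t^i` in stage `j`, on the cell between particles `i` and `i + 1`. The
density of the two unbounded outer cells `i = 0` and `i = n j` is zero. -/
def density (D : Run) (j i : ℕ) (t : ℝ) : ℝ :=
  if 1 ≤ i ∧ i < D.n j then
    (D.x j (i + 1) (D.τ j) - D.x j i (D.τ j)) / (D.x j (i + 1) t - D.x j i t) * D.w j i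
  else 0

/-- The velocity `V(v_t^{i-1}, v_t^i)` of particle `i` in stage `j`. -/
def nodeVelocity (f : ℝ → ℝ) (D : Run) (j i : ℕ) (t : ℝ) : ℝ :=
  velocity f (D.density j (i - 1) t) (D.density j i t)

/-- The labels of the particles of stage `j` that are kept at the end of the stage: of each group
of particles meeting at one point, only the rightmost one is kept (the rightmost particle of all
is always kept). -/
def survivors (D : Run) (j : ℕ) : Set ℕ :=
  {i | i ∈ Icc 1 (D.n j) ∧
    (i = D.n j ∨ D.x j i (D.τ (j + 1)) ≠ D.x j (i + 1) (D.τ (j + 1)))}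

/-- `D` is the run on `[0, T]` of the particle path scheme for the flux `f` and the initial datum
`u₀`, with `N` particles started at `y 1 < ⋯ < y N`. -/
structure IsOutput (f u₀ : ℝ → ℝ) (N : ℕ) (y : ℕ → ℝ) (T : ℝ) (D : Run) : Prop where
  time_zero : D.τ 0 = 0
  time_last : D.τ (D.m + 1) = T
  time_lt : ∀ j ≤ D.m, D.τ j < D.τ (j + 1)
  number_zero : D.n 0 = N
  position_zero : ∀ i ∈ Icc 1 N, D.x 0 i 0 = y i
  density_zero : ∀ i ∈ Ico 1 N, D.w 0 i = initialLocalDensity u₀ y i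
  continuousOn : ∀ j ≤ D.m, ∀ i ∈ Icc 1 (D.n j),
    ContinuousOn (D.x j i) (Icc (D.τ j) (D.τ (j + 1)))
  /-- The particle dynamics. -/
  ode : ∀ j ≤ D.m, ∀ i ∈ Icc 1 (D.n j), ∀ t ∈ Ioo (D.τ j) (D.τ (j + 1)),
    HasDerivAt (D.x j i) (D.nodeVelocity f j i t) t
  /-- There is no collision before the end of a stage … -/
  ordered : ∀ j ≤ D.m, ∀ t ∈ Ico (D.τ j) (D.τ (j + 1)), ∀ i ∈ Ico 1 (D.n j),
    D.x j i t < D.x j (i + 1) t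
  /-- … and there is one at the end of each stage but the last, which ends at `T`. -/
  collision : ∀ j < D.m, ∃ i ∈ Ico 1 (D.n j),
    D.x j i (D.τ (j + 1)) = D.x j (i + 1) (D.τ (j + 1))
  /-- After a collision the system is restarted from the remaining particles and densities,
  relabelled increasingly by `π`. -/
  restart : ∀ j < D.m, ∃ π : ℕ → ℕ,
    StrictMonoOn π (Icc 1 (D.n (j + 1))) ∧ π '' Icc 1 (D.n (j + 1)) = D.survivors j ∧
    (∀ i ∈ Icc 1 (D.n (j + 1)),
      D.x (j + 1) i (D.τ (j + 1)) = D.x j (π i) (D.τ (j + 1))) ∧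
    ∀ i ∈ Ico 1 (D.n (j + 1)), D.w (j + 1) i = D.density j (π i) (D.τ (j + 1))

/-- The stage to which the time `t ∈ [0, T]` belongs: `j` for `τ j ≤ t < τ (j + 1)`, and the last
stage `m` for `t = T`. -/
def stage (D : Run) (t : ℝ) : ℕ :=
  ((Finset.Icc 1 D.m).filter fun j => D.τ j ≤ t).card

/-- The approximate solution `v(z, t)`, piecewise constant in `z`. -/
def approx (D : Run) (z t : ℝ) : ℝ :=
  ∑ i ∈ Finset.Ico 1 (D.n (D.stage t)),
    (Ioo (D.x (D.stage t) i t) (D.x (D.stage t) (i + 1) t)).indicator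
      (fun _ => D.density (D.stage t) i t) z

/-- The velocity field `A(z, t)` in stage `j`: the piecewise linear interpolation of the particle
velocities at the particle positions, constant to the left of the first and to the right of the
last particle. -/
def stageField (f : ℝ → ℝ) (D : Run) (j : ℕ) (z t : ℝ) : ℝ :=
  (Iio (D.x j 1 t)).indicator (fun _ => D.nodeVelocity f j 1 t) z
  + ∑ i ∈ Finset.Ico 1 (D.n j),
      (Ico (D.x j i t) (D.x j (i + 1) t)).indicator
        (fun z =>
          (D.x j (i + 1) t - z) / (D.x j (i + 1) t - D.x j i t) * D.nodeVelocity f j i t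
          + (z - D.x j i t) / (D.x j (i + 1) t - D.x j i t) * D.nodeVelocity f j (i + 1) t) z
  + (Ici (D.x j (D.n j) t)).indicator (fun _ => D.nodeVelocity f j (D.n j) t) z

/-- The velocity field `A(z, t)`, globally in time. -/
def field (f : ℝ → ℝ) (D : Run) (z t : ℝ) : ℝ :=
  D.stageField f (D.stage t) z t

end Run

/-- The integrand `|v - k| ∂_t φ + (A v - f(k)) sgn(v - k) ∂_x φ` at the point `(z, t)`, for a
test function `φ` of the variables `(z, t)`. -/
def entropyIntegrand (f : ℝ → ℝ) (D : Run) (k : ℝ) (φ : ℝ × ℝ → ℝ) (z t : ℝ) : ℝ :=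
  |D.approx z t - k| * deriv (fun s => φ (z, s)) t
  + (D.field f z t * D.approx z t - f k) * Real.sign (D.approx z t - k)
      * deriv (fun q => φ (q, t)) z

end ParticlePath

end

noncomputable section

open scoped Topology

namespace ParticlePath

/-! ### Calculus preliminaries -/

/-! On a cell between paths `α`, `β` of length `h = β - α` the density is `v = c / h`, with `c` the
conserved mass. There the integrand equals `|v - k| (φ_t + A φ_x) + sgn(v - k) (k A - f k) φ_x`. As
`A` is affine between the end velocities, the points `α + s h` with `s` fixed move along `A`. In the
coordinate `s` the weighted entropy has density `h |v - k| φ = |c - k h| φ`, and its time derivative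
differs from the integrand by `sgn(v - k)` times the exact derivative of `(k A - f k) φ`. Hence the
space integral over a cell is the rate of change of its entropy plus a difference of fluxes at its
two ends (`integral_cellIntegrand`).

Summing over cells by parts leaves at each particle the flux `(k V - f k) φ` times the drop of
`sgn(v - k)` across it. This is nonnegative by the choice of `V` as a minimum or maximum of `a`
(`sign_sub_sign_mul_nonneg`). Two fixed nodes beyond the support of `φ` close the outer cells
without flux. Integration in time gives the inequality on one stage (`sum_cellEnergy_sub_le`,
`stageEnergy_sub_le`).

The form `|c - k h|` contains no division and stays continuous when a cell collapses. A collapsed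
cell retains a nonnegative entropy in this form but contributes nothing to the space integral, so
dropping it only helps (`stageEnergy_end_le`). Deletion does not alter `v` (`stageApprox_succ`), so
the stage inequalities telescope over `[0, T]`. -/

theorem measurable_realSign : Measurable Real.sign := by
  unfold Real.sign
  exact Measurable.ite measurableSet_Iio measurable_const
    (Measurable.ite measurableSet_Ioi measurable_const measurable_const)

theorem abs_realSign_le (r : ℝ) : |Real.sign r| ≤ 1 := by
  rcases Real.sign_apply_eq r with h | h | h <;> simp [h]

theorem abs_eq_sign_mul_self (r : ℝ) : |r| = Real.sign r * r := by
  rcases lt_trichotomy r 0 with h | h | h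
  · rw [Real.sign_of_neg h, abs_of_neg h]; ring
  · simp [h]
  · rw [Real.sign_of_pos h, abs_of_pos h]; ring

/-- A function differentiable on a set `s` has only countably many zeros in `s` at which its
derivative does not vanish. -/
theorem countable_simple_zeros {g : ℝ → ℝ} {s : Set ℝ} (hg : ∀ t ∈ s, DifferentiableAt ℝ g t) :
    {t ∈ s | g t = 0 ∧ deriv g t ≠ 0}.Countable := by
  refine (countable_setOfPred_isolated_right_within
    (s := {t ∈ s | g t = 0 ∧ deriv g t ≠ 0})).mono ?_
  intro t ht
  have h := (hg t ht.1).hasDerivAt.eventually_ne (c := 0) ht.2.2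
  refine ⟨ht, Filter.empty_mem_iff_bot.1 ?_⟩
  have h1 : 𝓝[{t ∈ s | g t = 0 ∧ deriv g t ≠ 0} ∩ Ioi t] t ≤ 𝓝[≠] t :=
    nhdsWithin_mono t fun r hr => (ne_of_gt hr.2 : r ≠ t)
  filter_upwards [h1 h, self_mem_nhdsWithin] with r hr hr'
  exact hr hr'.1.2.1

/-- At a zero with vanishing derivative, `g` is `o(s - t)` and so is `|g|`; the convention `sgn 0 =
0` is harmless there. -/
theorem hasDerivAt_abs_of_deriv_eq_zero {g : ℝ → ℝ} {g' t : ℝ} (hg : HasDerivAt g g' t)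
    (h : g t = 0 → g' = 0) : HasDerivAt (fun s => |g s|) (Real.sign (g t) * g') t := by
  rcases lt_trichotomy (g t) 0 with h0 | h0 | h0
  · rw [Real.sign_of_neg h0]
    exact (hasDerivAt_abs_neg h0).comp t hg
  · have := h h0
    subst this
    rw [mul_zero]
    rw [hasDerivAt_iff_isLittleO] at hg ⊢
    simp only [h0, smul_zero, sub_zero, abs_zero] at hg ⊢
    exact hg.abs_left
  · rw [Real.sign_of_pos h0]
    exact (hasDerivAt_abs_pos h0).comp t hg

/-! ### Partial derivatives of test functions. -/

section Partials

variable {φ : ℝ × ℝ → ℝ}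

theorem hasDerivAt_comp_curve (hφ : ContDiff ℝ ∞ φ) {γ : ℝ → ℝ} {g t : ℝ}
    (hγ : HasDerivAt γ g t) :
    HasDerivAt (fun s => φ (γ s, s))
      (deriv (fun q => φ (q, t)) (γ t) * g + deriv (fun s => φ (γ t, s)) t) t := by
  have hd : DifferentiableAt ℝ φ (γ t, t) := hφ.differentiable (by simp) _
  have h1 : HasDerivAt (fun q => φ (q, t)) (fderiv ℝ φ (γ t, t) (1, 0)) (γ t) :=
    hd.hasFDerivAt.comp_hasDerivAt (γ t) ((hasDerivAt_id (γ t)).prodMk (hasDerivAt_const _ t))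
  have h2 : HasDerivAt (fun s => φ (γ t, s)) (fderiv ℝ φ (γ t, t) (0, 1)) t :=
    hd.hasFDerivAt.comp_hasDerivAt t ((hasDerivAt_const t (γ t)).prodMk (hasDerivAt_id t))
  have h3 : HasDerivAt (fun s => φ (γ s, s)) (fderiv ℝ φ (γ t, t) (g, 1)) t :=
    HasFDerivAt.comp_hasDerivAt (f := fun s => (γ s, s)) t hd.hasFDerivAt
      (hγ.prodMk (hasDerivAt_id t))
  rw [h1.deriv, h2.deriv]
  convert h3 using 1
  have : ((g, 1) : ℝ × ℝ) = g • ((1, 0) : ℝ × ℝ) + (0, 1) := by simp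
  rw [this, map_add, map_smul, smul_eq_mul, mul_comm]

theorem hasDerivAt_fst (hφ : ContDiff ℝ ∞ φ) (z t : ℝ) :
    HasDerivAt (fun q => φ (q, t)) (deriv (fun q => φ (q, t)) z) z :=
  ((hφ.comp (contDiff_id.prodMk contDiff_const)).differentiable (by simp) z).hasDerivAt

theorem deriv_fst_eq (hφ : ContDiff ℝ ∞ φ) (p : ℝ × ℝ) :
    deriv (fun q => φ (q, p.2)) p.1 = fderiv ℝ φ p (1, 0) :=
  ((hφ.differentiable (by simp) p).hasFDerivAt.comp_hasDerivAt p.1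
    ((hasDerivAt_id p.1).prodMk (hasDerivAt_const _ p.2))).deriv

theorem deriv_snd_eq (hφ : ContDiff ℝ ∞ φ) (p : ℝ × ℝ) :
    deriv (fun s => φ (p.1, s)) p.2 = fderiv ℝ φ p (0, 1) :=
  ((hφ.differentiable (by simp) p).hasFDerivAt.comp_hasDerivAt p.2
    ((hasDerivAt_const p.2 p.1).prodMk (hasDerivAt_id p.2))).deriv

theorem continuous_fderiv_apply (hφ : ContDiff ℝ ∞ φ) (e : ℝ × ℝ) :
    Continuous fun p => fderiv ℝ φ p e :=
  (hφ.continuous_fderiv (by simp)).clm_apply continuous_const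

theorem continuous_deriv_fst (hφ : ContDiff ℝ ∞ φ) :
    Continuous fun p : ℝ × ℝ => deriv (fun q => φ (q, p.2)) p.1 := by
  simpa only [deriv_fst_eq hφ] using continuous_fderiv_apply hφ (1, 0)

theorem continuous_deriv_snd (hφ : ContDiff ℝ ∞ φ) :
    Continuous fun p : ℝ × ℝ => deriv (fun s => φ (p.1, s)) p.2 := by
  simpa only [deriv_snd_eq hφ] using continuous_fderiv_apply hφ (0, 1)

theorem hasCompactSupport_deriv_fst (hφ : ContDiff ℝ ∞ φ) (hs : HasCompactSupport φ) :
    HasCompactSupport fun p : ℝ × ℝ => deriv (fun q => φ (q, p.2)) p.1 := by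
  simpa only [deriv_fst_eq hφ] using hs.fderiv_apply ℝ (1, 0)

theorem hasCompactSupport_deriv_snd (hφ : ContDiff ℝ ∞ φ) (hs : HasCompactSupport φ) :
    HasCompactSupport fun p : ℝ × ℝ => deriv (fun s => φ (p.1, s)) p.2 := by
  simpa only [deriv_snd_eq hφ] using hs.fderiv_apply ℝ (0, 1)

/-- A common bound for a test function and its first partial derivatives. -/
theorem exists_common_bound (hφ : ContDiff ℝ ∞ φ) (hs : HasCompactSupport φ) :
    ∃ C : ℝ, 0 ≤ C ∧ ∀ z t : ℝ, |φ (z, t)| ≤ C ∧ |deriv (fun q => φ (q, t)) z| ≤ C ∧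
      |deriv (fun s => φ (z, s)) t| ≤ C := by
  obtain ⟨C₀, h₀⟩ := hφ.continuous.bounded_above_of_compact_support hs
  obtain ⟨C₁, h₁⟩ := (continuous_deriv_fst hφ).bounded_above_of_compact_support
    (hasCompactSupport_deriv_fst hφ hs)
  obtain ⟨C₂, h₂⟩ := (continuous_deriv_snd hφ).bounded_above_of_compact_support
    (hasCompactSupport_deriv_snd hφ hs)
  refine ⟨max C₀ (max C₁ C₂), ?_, fun z t => ⟨?_, ?_, ?_⟩⟩
  · exact ((norm_nonneg _).trans (h₀ (0, 0))).trans (le_max_left _ _)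
  · exact (h₀ (z, t)).trans (le_max_left _ _)
  · exact (h₁ (z, t)).trans ((le_max_left _ _).trans (le_max_right _ _))
  · exact (h₂ (z, t)).trans ((le_max_right _ _).trans (le_max_right _ _))

end Partials

/-! ### One cell -/

/-- The path of a particle on `[a, b]`, with speed at most `L`, continued to all times. -/
structure IsPath (a b L : ℝ) (α : ℝ → ℝ) : Prop where
  continuous : Continuous α
  differentiableAt : ∀ t ∈ Ioo a b, DifferentiableAt ℝ α t
  abs_deriv_le : ∀ t ∈ Ioo a b, |deriv α t| ≤ L

/-- The entropy integrand, with the constant `κ` for `f k`, in a cell of mass `c` between the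
particle paths `α` and `β`. -/
def cellIntegrand (k κ : ℝ) (φ : ℝ × ℝ → ℝ) (c : ℝ) (α β : ℝ → ℝ) (z t : ℝ) : ℝ :=
  |c / (β t - α t) - k| * deriv (fun s => φ (z, s)) t
  + (((β t - z) / (β t - α t) * deriv α t + (z - α t) / (β t - α t) * deriv β t)
      * (c / (β t - α t)) - κ) * Real.sign (c / (β t - α t) - k) * deriv (fun q => φ (q, t)) z

/-- The weighted entropy in the cell, in the coordinate `s ∈ [0, 1]` given by
`z = α + s (β - α)`. -/
def cellEnergy (k : ℝ) (φ : ℝ × ℝ → ℝ) (c : ℝ) (α β : ℝ → ℝ) (t : ℝ) : ℝ :=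
  ∫ s in (0 : ℝ)..1, |c - k * (β t - α t)| * φ (α t + s * (β t - α t), t)

/-- The time derivative of the integrand of `cellEnergy`. -/
def cellRate (k : ℝ) (φ : ℝ × ℝ → ℝ) (c : ℝ) (α β : ℝ → ℝ) (s t : ℝ) : ℝ :=
  Real.sign (c - k * (β t - α t)) * -(k * (deriv β t - deriv α t))
      * φ (α t + s * (β t - α t), t)
  + |c - k * (β t - α t)| *
      (deriv (fun q => φ (q, t)) (α t + s * (β t - α t))
          * (deriv α t + s * (deriv β t - deriv α t))
        + deriv (fun r => φ (α t + s * (β t - α t), r)) t)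

/-- The entropy flux through the path `α`. -/
def nodeFlux (k κ : ℝ) (φ : ℝ × ℝ → ℝ) (α : ℝ → ℝ) (t : ℝ) : ℝ :=
  (k * deriv α t - κ) * φ (α t, t)

section Cell

variable {a b L k κ c : ℝ} {φ : ℝ × ℝ → ℝ} {α β : ℝ → ℝ}

theorem measurable_cellRate (hφ : ContDiff ℝ ∞ φ) (hα : Continuous α) (hβ : Continuous β) :
    Measurable fun p : ℝ × ℝ => cellRate k φ c α β p.1 p.2 := by
  have hα' : Measurable fun p : ℝ × ℝ => deriv α p.2 := (measurable_deriv α).comp measurable_snd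
  have hβ' : Measurable fun p : ℝ × ℝ => deriv β p.2 := (measurable_deriv β).comp measurable_snd
  have hz : Continuous fun p : ℝ × ℝ => (α p.2 + p.1 * (β p.2 - α p.2), p.2) := by fun_prop
  have h1 := (hφ.continuous.comp hz).measurable
  have h2 := ((continuous_deriv_fst hφ).comp hz).measurable
  have h3 := ((continuous_deriv_snd hφ).comp hz).measurable
  have h4 : Measurable fun p : ℝ × ℝ => c - k * (β p.2 - α p.2) := by fun_prop
  have h5 := measurable_realSign.comp h4
  simp only [Function.comp_def] at h1 h2 h3 h5
  unfold cellRate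
  exact ((h5.mul (measurable_const.mul (hβ'.sub hα')).neg).mul h1).add
    (h4.abs.mul ((h2.mul (hα'.add (measurable_fst.mul (hβ'.sub hα')))).add h3))

theorem measurable_cellIntegrand (hφ : ContDiff ℝ ∞ φ) (hα : Continuous α) (hβ : Continuous β) :
    Measurable fun p : ℝ × ℝ => cellIntegrand k κ φ c α β p.1 p.2 := by
  have hα' : Measurable fun p : ℝ × ℝ => deriv α p.2 := (measurable_deriv α).comp measurable_snd
  have hβ' : Measurable fun p : ℝ × ℝ => deriv β p.2 := (measurable_deriv β).comp measurable_snd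
  have h0α : Measurable fun p : ℝ × ℝ => α p.2 := hα.measurable.comp measurable_snd
  have h0β : Measurable fun p : ℝ × ℝ => β p.2 := hβ.measurable.comp measurable_snd
  have h2 := (continuous_deriv_fst hφ).measurable
  have h3 := (continuous_deriv_snd hφ).measurable
  have hv : Measurable fun p : ℝ × ℝ => c / (β p.2 - α p.2) :=
    measurable_const.div (h0β.sub h0α)
  have h5 : Measurable fun p : ℝ × ℝ => Real.sign (c / (β p.2 - α p.2) - k) :=
    measurable_realSign.comp (hv.sub_const k)
  unfold cellIntegrand
  exact ((hv.sub_const k).abs.mul h3).add (((((((h0β.sub measurable_fst).div (h0β.sub h0α)).mul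
    hα').add (((measurable_fst.sub h0α).div (h0β.sub h0α)).mul hβ')).mul hv).sub_const κ).mul
      h5 |>.mul h2)

theorem continuous_cellIntegrand_fst (hφ : ContDiff ℝ ∞ φ) (t : ℝ) :
    Continuous fun z => cellIntegrand k κ φ c α β z t := by
  have hz : Continuous fun z : ℝ => (z, t) := by fun_prop
  have h2 := (continuous_deriv_fst hφ).comp hz
  have h3 := (continuous_deriv_snd hφ).comp hz
  simp only [Function.comp_def] at h2 h3
  unfold cellIntegrand
  refine (continuous_const.mul h3).add (Continuous.mul ?_ h2)
  simp only [div_eq_mul_inv]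
  fun_prop

theorem realSign_pos_mul {h : ℝ} (hh : 0 < h) (x : ℝ) : Real.sign (h * x) = Real.sign x := by
  rcases lt_trichotomy x 0 with hx | hx | hx
  · rw [Real.sign_of_neg hx, Real.sign_of_neg (mul_neg_of_pos_of_neg hh hx)]
  · simp [hx]
  · rw [Real.sign_of_pos hx, Real.sign_of_pos (mul_pos hh hx)]

/-- No cell length occurs in a denominator, so the bound persists up to a collision. -/
theorem exists_bound_cellRate (hφ : ContDiff ℝ ∞ φ) (hs : HasCompactSupport φ)
    (hα : IsPath a b L α) (hβ : IsPath a b L β) :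
    ∃ M : ℝ, ∀ s ∈ Icc (0 : ℝ) 1, ∀ t ∈ Ioo a b, |cellRate k φ c α β s t| ≤ M := by
  obtain ⟨C, hC, hb⟩ := exists_common_bound hφ hs
  have hcont : Continuous fun t => c - k * (β t - α t) := by
    have := hα.continuous
    have := hβ.continuous
    fun_prop
  obtain ⟨B, hB⟩ := (isCompact_Icc (a := a) (b := b)).exists_bound_of_continuousOn
    hcont.continuousOn
  refine ⟨1 * (|k| * (L + L)) * C + B * (C * (L + 1 * (L + L)) + C), fun s hs t ht => ?_⟩
  have hp := hα.abs_deriv_le t ht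
  have hq := hβ.abs_deriv_le t ht
  have hqp : |deriv β t - deriv α t| ≤ L + L := (abs_sub _ _).trans (add_le_add hq hp)
  have hL : 0 ≤ L := (abs_nonneg _).trans hp
  have hB' : |c - k * (β t - α t)| ≤ B := hB t (Ioo_subset_Icc_self ht)
  have hB0 : 0 ≤ B := (abs_nonneg _).trans hB'
  obtain ⟨h1, h2, h3⟩ := hb (α t + s * (β t - α t)) t
  have hs1 : |s| ≤ 1 := by rw [abs_of_nonneg hs.1]; exact hs.2
  unfold cellRate
  refine (abs_add_le _ _).trans (add_le_add ?_ ?_)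
  · rw [abs_mul, abs_mul, abs_neg, abs_mul]
    have := abs_realSign_le (c - k * (β t - α t))
    gcongr
  · rw [abs_mul, abs_abs]
    refine mul_le_mul hB' ((abs_add_le _ _).trans (add_le_add ?_ h3)) (abs_nonneg _) hB0
    rw [abs_mul]
    refine mul_le_mul h2 ((abs_add_le _ _).trans (add_le_add hp ?_)) (abs_nonneg _) hC
    rw [abs_mul]
    gcongr

theorem integrable_cellRate (hφ : ContDiff ℝ ∞ φ) (hs : HasCompactSupport φ)
    (hα : IsPath a b L α) (hβ : IsPath a b L β) :
    Integrable (fun p : ℝ × ℝ => cellRate k φ c α β p.1 p.2)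
      ((volume.restrict (Ioc 0 1)).prod (volume.restrict (Ioo a b))) := by
  obtain ⟨M, hM⟩ := exists_bound_cellRate (k := k) (c := c) hφ hs hα hβ
  refine Integrable.of_bound
    (measurable_cellRate hφ hα.continuous hβ.continuous).aestronglyMeasurable M ?_
  rw [Measure.prod_restrict]
  filter_upwards [ae_restrict_mem (measurableSet_Ioc.prod measurableSet_Ioo)] with p hp
  exact hM p.1 (Ioc_subset_Icc_self hp.1) p.2 hp.2

theorem intervalIntegrable_integral_cellRate (hab : a ≤ b) (hφ : ContDiff ℝ ∞ φ)
    (hs : HasCompactSupport φ) (hα : IsPath a b L α) (hβ : IsPath a b L β) :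
    IntervalIntegrable (fun t => ∫ s in (0 : ℝ)..1, cellRate k φ c α β s t) volume a b := by
  rw [intervalIntegrable_iff_integrableOn_Ioo_of_le hab]
  simp only [intervalIntegral.integral_of_le zero_le_one]
  exact (integrable_cellRate hφ hs hα hβ).integral_prod_right

/-- The fundamental theorem of calculus tolerates a countable exceptional set. It suffices to
exclude the simple zeros of `c - k (β - α)`, and the path velocities need only be bounded, not
continuous. -/
theorem integral_cellRate_time (hab : a ≤ b) (hφ : ContDiff ℝ ∞ φ) (hs : HasCompactSupport φ)
    (hα : IsPath a b L α) (hβ : IsPath a b L β) {s : ℝ} (hs01 : s ∈ Icc (0 : ℝ) 1) :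
    ∫ t in a..b, cellRate k φ c α β s t =
      |c - k * (β b - α b)| * φ (α b + s * (β b - α b), b)
      - |c - k * (β a - α a)| * φ (α a + s * (β a - α a), a) := by
  have hαc := hα.continuous
  have hβc := hβ.continuous
  have hder : ∀ t ∈ Ioo a b, HasDerivAt (fun t => c - k * (β t - α t))
      (-(k * (deriv β t - deriv α t))) t := fun t ht =>
    (((hβ.differentiableAt t ht).hasDerivAt.sub (hα.differentiableAt t ht).hasDerivAt).const_mul
      k).const_sub c
  refine integral_eq_of_hasDerivAt_off_countable_of_le
    (fun t => |c - k * (β t - α t)| * φ (α t + s * (β t - α t), t)) _ hab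
    (countable_simple_zeros fun t ht => (hder t ht).differentiableAt) ?_ ?_ ?_
  · have := hφ.continuous
    fun_prop
  · rintro t ⟨ht, hns⟩
    have h1 := hasDerivAt_abs_of_deriv_eq_zero (hder t ht) fun h0 => by
      by_contra hne
      exact hns ⟨ht, h0, by rwa [(hder t ht).deriv]⟩
    have h2 := hasDerivAt_comp_curve hφ ((hα.differentiableAt t ht).hasDerivAt.add
      (((hβ.differentiableAt t ht).hasDerivAt.sub
        (hα.differentiableAt t ht).hasDerivAt).const_mul s))
    exact h1.mul h2
  · obtain ⟨M, hM⟩ := exists_bound_cellRate (k := k) (c := c) hφ hs hα hβ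
    rw [intervalIntegrable_iff_integrableOn_Ioo_of_le hab]
    refine Integrable.of_bound ((measurable_cellRate hφ hαc hβc).comp
      (measurable_const.prodMk measurable_id : Measurable fun t : ℝ => (s, t))
      ).aestronglyMeasurable M ?_
    filter_upwards [ae_restrict_mem measurableSet_Ioo] with t ht
    exact hM s hs01 t ht

theorem continuous_cellEnergy_integrand (hφ : ContDiff ℝ ∞ φ) (t : ℝ) :
    Continuous fun s : ℝ => |c - k * (β t - α t)| * φ (α t + s * (β t - α t), t) := by
  have := hφ.continuous
  fun_prop

/-- The energy balance of a cell in the coordinate `s`. -/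
theorem integral_integral_cellRate (hab : a ≤ b) (hφ : ContDiff ℝ ∞ φ)
    (hs : HasCompactSupport φ) (hα : IsPath a b L α) (hβ : IsPath a b L β) :
    ∫ t in a..b, ∫ s in (0 : ℝ)..1, cellRate k φ c α β s t =
      cellEnergy k φ c α β b - cellEnergy k φ c α β a := by
  have h1 : ∫ t in a..b, ∫ s in (0 : ℝ)..1, cellRate k φ c α β s t =
      ∫ s in (0 : ℝ)..1, ∫ t in a..b, cellRate k φ c α β s t := by
    simp only [intervalIntegral.integral_of_le hab, intervalIntegral.integral_of_le zero_le_one,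
      integral_Ioc_eq_integral_Ioo (x := a) (y := b)]
    exact (integral_integral_swap (integrable_cellRate hφ hs hα hβ)).symm
  rw [h1, cellEnergy, cellEnergy, ← intervalIntegral.integral_sub
    ((continuous_cellEnergy_integrand hφ b).intervalIntegrable _ _)
    ((continuous_cellEnergy_integrand hφ a).intervalIntegrable _ _)]
  refine intervalIntegral.integral_congr fun s hs01 => ?_
  rw [uIcc_of_le zero_le_one] at hs01
  exact integral_cellRate_time hab hφ hs hα hβ hs01

theorem continuous_cellRate_fst (hφ : ContDiff ℝ ∞ φ) (t : ℝ) :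
    Continuous fun s => cellRate k φ c α β s t := by
  have hz : Continuous fun s : ℝ => (α t + s * (β t - α t), t) := by fun_prop
  have h1 := hφ.continuous.comp hz
  have h2 := (continuous_deriv_fst hφ).comp hz
  have h3 := (continuous_deriv_snd hφ).comp hz
  simp only [Function.comp_def] at h1 h2 h3
  unfold cellRate
  fun_prop

/-- The space integral of the entropy integrand over a cell: rate of change of the energy plus
the fluxes through the end points. -/
theorem integral_cellIntegrand (hφ : ContDiff ℝ ∞ φ) {t : ℝ} (hlt : α t < β t) :
    ∫ z in (α t)..(β t), cellIntegrand k κ φ c α β z t =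
      (∫ s in (0 : ℝ)..1, cellRate k φ c α β s t)
      + Real.sign (c / (β t - α t) - k) * (nodeFlux k κ φ β t - nodeFlux k κ φ α t) := by
  have hh : 0 < β t - α t := sub_pos.2 hlt
  have hne := hh.ne'
  have hv : c - k * (β t - α t) = (β t - α t) * (c / (β t - α t) - k) := by
    field_simp
  have hsub := intervalIntegral.integral_comp_add_mul (a := 0) (b := 1)
    (fun z => cellIntegrand k κ φ c α β z t) hne (α t)
  simp only [mul_zero, add_zero, mul_one, add_sub_cancel, smul_eq_mul] at hsub
  -- This is the flux `(k A - κ) φ` along the cell, where `A` is affine in `s`. The sign of `v - k`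
  -- is constant on the cell, so integrating the derivative leaves end-point values only.
  have hflux : ∀ s : ℝ, HasDerivAt
      (fun s => (k * (deriv α t + s * (deriv β t - deriv α t)) - κ)
        * φ (α t + s * (β t - α t), t))
      (k * (deriv β t - deriv α t) * φ (α t + s * (β t - α t), t)
        + (k * (deriv α t + s * (deriv β t - deriv α t)) - κ)
          * (deriv (fun q => φ (q, t)) (α t + s * (β t - α t)) * (β t - α t))) s := by
    intro s
    have e1 : HasDerivAt (fun s : ℝ => α t + s * (β t - α t)) (β t - α t) s := by
      simpa using ((hasDerivAt_id s).mul_const (β t - α t)).const_add (α t)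
    have e2 : HasDerivAt (fun s : ℝ => k * (deriv α t + s * (deriv β t - deriv α t)) - κ)
        (k * (deriv β t - deriv α t)) s := by
      simpa using ((((hasDerivAt_id s).mul_const (deriv β t - deriv α t)).const_add
        (deriv α t)).const_mul k).sub_const κ
    exact e2.mul ((hasDerivAt_fst hφ _ t).comp s e1)
  have hcont : Continuous fun s : ℝ =>
      k * (deriv β t - deriv α t) * φ (α t + s * (β t - α t), t)
        + (k * (deriv α t + s * (deriv β t - deriv α t)) - κ)
          * (deriv (fun q => φ (q, t)) (α t + s * (β t - α t)) * (β t - α t)) := by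
    have hz : Continuous fun s : ℝ => (α t + s * (β t - α t), t) := by fun_prop
    have h1 := hφ.continuous.comp hz
    have h2 := (continuous_deriv_fst hφ).comp hz
    simp only [Function.comp_def] at h1 h2
    fun_prop
  have hftc := intervalIntegral.integral_eq_sub_of_hasDerivAt (fun s _ => hflux s)
    (hcont.intervalIntegrable 0 1)
  -- Algebraically this is `A v - κ = A (v - k) + (k A - κ)` together with `|v - k| = sgn(v - k) (v
  -- - k)`.
  have hpt : ∀ s : ℝ, (β t - α t) * cellIntegrand k κ φ c α β (α t + (β t - α t) * s) t =
      cellRate k φ c α β s t + Real.sign (c / (β t - α t) - k) *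
        (k * (deriv β t - deriv α t) * φ (α t + s * (β t - α t), t)
        + (k * (deriv α t + s * (deriv β t - deriv α t)) - κ)
          * (deriv (fun q => φ (q, t)) (α t + s * (β t - α t)) * (β t - α t))) := by
    intro s
    unfold cellIntegrand cellRate
    rw [hv, realSign_pos_mul hh, abs_mul, abs_of_pos hh, mul_comm (β t - α t) s,
      abs_eq_sign_mul_self]
    have e1 : (β t - (α t + s * (β t - α t))) / (β t - α t) = 1 - s := by
      field_simp; ring
    have e2 : (α t + s * (β t - α t) - α t) / (β t - α t) = s := by
      field_simp; ring
    rw [e1, e2]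
    ring
  have : ∫ z in (α t)..(β t), cellIntegrand k κ φ c α β z t = ∫ s in (0 : ℝ)..1,
      (β t - α t) * cellIntegrand k κ φ c α β (α t + (β t - α t) * s) t := by
    rw [intervalIntegral.integral_const_mul, hsub, mul_inv_cancel_left₀ hne]
  rw [this]
  simp only [hpt]
  rw [intervalIntegral.integral_add ((continuous_cellRate_fst hφ t).intervalIntegrable _ _)
    ((hcont.const_mul _).intervalIntegrable _ _), intervalIntegral.integral_const_mul, hftc]
  simp [nodeFlux]

theorem intervalIntegrable_sign_mul_nodeFlux (hab : a ≤ b) (hφ : ContDiff ℝ ∞ φ)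
    (hs : HasCompactSupport φ) (hα : IsPath a b L α) (hβ : IsPath a b L β) :
    IntervalIntegrable (fun t => Real.sign (c / (β t - α t) - k)
      * (nodeFlux k κ φ β t - nodeFlux k κ φ α t)) volume a b := by
  obtain ⟨C, hC, hb⟩ := exists_common_bound hφ hs
  have hflux : ∀ γ, IsPath a b L γ → Measurable (nodeFlux k κ φ γ) ∧
      ∀ t ∈ Ioo a b, |nodeFlux k κ φ γ t| ≤ (|k| * L + |κ|) * C := by
    intro γ hγ
    refine ⟨((measurable_const.mul (measurable_deriv γ)).sub_const κ).mul
      (hφ.continuous.comp (hγ.continuous.prodMk continuous_id)).measurable, fun t ht => ?_⟩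
    unfold nodeFlux
    have h1 := hγ.abs_deriv_le t ht
    have hL : 0 ≤ L := (abs_nonneg _).trans h1
    rw [abs_mul]
    refine mul_le_mul ((abs_sub _ _).trans ?_) (hb _ _).1 (abs_nonneg _) (by positivity)
    rw [abs_mul]
    gcongr
  rw [intervalIntegrable_iff_integrableOn_Ioo_of_le hab]
  refine Integrable.of_bound (C := 1 * ((|k| * L + |κ|) * C + (|k| * L + |κ|) * C))
    ((measurable_realSign.comp ((measurable_const.div (hβ.continuous.measurable.sub
      hα.continuous.measurable)).sub_const k)).mul
        ((hflux β hβ).1.sub (hflux α hα).1)).aestronglyMeasurable ?_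
  filter_upwards [ae_restrict_mem measurableSet_Ioo] with t ht
  rw [Real.norm_eq_abs, abs_mul]
  exact mul_le_mul (abs_realSign_le _) ((abs_sub _ _).trans
    (add_le_add ((hflux β hβ).2 t ht) ((hflux α hα).2 t ht))) (abs_nonneg _) zero_le_one

/-- The region swept by the cell between `α` and `β` during `(a, b)`. -/
def cellRegion (a b : ℝ) (α β : ℝ → ℝ) : Set (ℝ × ℝ) :=
  {p | p.2 ∈ Ioo a b ∧ p.1 ∈ Ioo (α p.2) (β p.2)}

theorem measurableSet_cellRegion (hα : Continuous α) (hβ : Continuous β) :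
    MeasurableSet (cellRegion a b α β) := by
  have : IsOpen (cellRegion a b α β) :=
    (isOpen_Ioo.preimage continuous_snd).inter
      ((isOpen_lt (hα.comp continuous_snd) continuous_fst).inter
        (isOpen_lt continuous_fst (hβ.comp continuous_snd)))
  exact this.measurableSet

/-- The inverse length is kept explicit because integration over the cell will cancel it. The factor
`2 * L` bounds the interpolated velocity, each weight being at most `1`. -/
theorem abs_cellIntegrand_le {C : ℝ} {z t : ℝ} (hC : ∀ z t : ℝ,
    |φ (z, t)| ≤ C ∧ |deriv (fun q => φ (q, t)) z| ≤ C ∧ |deriv (fun s => φ (z, s)) t| ≤ C)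
    (hα : |deriv α t| ≤ L) (hβ : |deriv β t| ≤ L) (hz : z ∈ Ioo (α t) (β t)) :
    |cellIntegrand k κ φ c α β z t| ≤
      (|c| / (β t - α t)) * ((1 + 2 * L) * C) + (|k| + |κ|) * C := by
  obtain ⟨hz1, hz2⟩ := hz
  have hh : 0 < β t - α t := by linarith
  obtain ⟨h1, h2, h3⟩ := hC z t
  have hC0 : 0 ≤ C := (abs_nonneg _).trans h1
  have hL : 0 ≤ L := (abs_nonneg _).trans hα
  have hv : |c / (β t - α t)| = |c| / (β t - α t) := by rw [abs_div, abs_of_pos hh]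
  have hw1 : |(β t - z) / (β t - α t)| ≤ 1 := by
    rw [abs_of_nonneg (div_nonneg (by linarith) hh.le), div_le_one hh]; linarith
  have hw2 : |(z - α t) / (β t - α t)| ≤ 1 := by
    rw [abs_of_nonneg (div_nonneg (by linarith) hh.le), div_le_one hh]; linarith
  have hA : |(β t - z) / (β t - α t) * deriv α t + (z - α t) / (β t - α t) * deriv β t|
      ≤ 2 * L := by
    refine (abs_add_le _ _).trans ?_
    rw [abs_mul, abs_mul]
    have e1 := mul_le_mul hw1 hα (abs_nonneg _) zero_le_one
    have e2 := mul_le_mul hw2 hβ (abs_nonneg _) zero_le_one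
    linarith
  unfold cellIntegrand
  have e1 : |(|c / (β t - α t) - k| * deriv (fun s => φ (z, s)) t)| ≤
      (|c| / (β t - α t) + |k|) * C := by
    rw [abs_mul, abs_abs]
    have := abs_sub (c / (β t - α t)) k
    rw [hv] at this
    gcongr
  have e2 : |(((β t - z) / (β t - α t) * deriv α t + (z - α t) / (β t - α t) * deriv β t)
      * (c / (β t - α t)) - κ) * Real.sign (c / (β t - α t) - k) * deriv (fun q => φ (q, t)) z|
      ≤ (2 * L * (|c| / (β t - α t)) + |κ|) * 1 * C := by
    rw [abs_mul, abs_mul]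
    have e3 := abs_sub (((β t - z) / (β t - α t) * deriv α t
      + (z - α t) / (β t - α t) * deriv β t) * (c / (β t - α t))) κ
    rw [abs_mul, hv] at e3
    have e4 := abs_realSign_le (c / (β t - α t) - k)
    have e5 : 0 ≤ |c| / (β t - α t) := by positivity
    refine mul_le_mul (mul_le_mul (e3.trans ?_) e4 (abs_nonneg _) (by positivity)) h2
      (abs_nonneg _) (by positivity)
    gcongr
  refine (abs_add_le _ _).trans ((add_le_add e1 e2).trans (le_of_eq ?_))
  ring

/-- The integrand may blow up like the inverse cell length at a collision, but its `L¹` norm on each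
time slice stays bounded, so Tonelli's theorem applies. -/
theorem integrableOn_cellIntegrand (hφ : ContDiff ℝ ∞ φ) (hs : HasCompactSupport φ)
    (hα : IsPath a b L α) (hβ : IsPath a b L β) (hlt : ∀ t ∈ Ioo a b, α t < β t) :
    IntegrableOn (fun p : ℝ × ℝ => cellIntegrand k κ φ c α β p.1 p.2)
      (cellRegion a b α β) volume := by
  obtain ⟨C, hC, hb⟩ := exists_common_bound hφ hs
  have hαc := hα.continuous
  have hβc := hβ.continuous
  have hms : MeasurableSet (cellRegion a b α β) := measurableSet_cellRegion hαc hβc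
  have hslice : ∀ t ∈ Ioo a b, ∀ z, (cellRegion a b α β).indicator
      (fun p : ℝ × ℝ => cellIntegrand k κ φ c α β p.1 p.2) (z, t) =
      (Ioo (α t) (β t)).indicator (fun z => cellIntegrand k κ φ c α β z t) z := by
    intro t ht z
    by_cases hz : z ∈ Ioo (α t) (β t)
    · rw [indicator_of_mem hz, indicator_of_mem (show (z, t) ∈ cellRegion a b α β from ⟨ht, hz⟩)]
    · rw [indicator_of_notMem hz, indicator_of_notMem fun h => hz h.2]
  have hint : ∀ t, Integrable
      ((Ioo (α t) (β t)).indicator fun z => cellIntegrand k κ φ c α β z t) volume := by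
    intro t
    rw [integrable_indicator_iff measurableSet_Ioo]
    exact ((continuous_cellIntegrand_fst hφ t).integrableOn_Icc).mono_set Ioo_subset_Icc_self
  obtain ⟨B, hB⟩ := (isCompact_Icc (a := a) (b := b)).exists_bound_of_continuousOn
    (hβc.sub hαc).continuousOn
  rw [← integrable_indicator_iff hms]
  have hmeas := (measurable_cellIntegrand (k := k) (κ := κ) (c := c) hφ hαc hβc).indicator hms
  suffices h : IntegrableOn ((cellRegion a b α β).indicator
      fun p : ℝ × ℝ => cellIntegrand k κ φ c α β p.1 p.2) (univ ×ˢ Ioo a b) volume by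
    rw [integrableOn_iff_integrable_of_support_subset] at h
    · exact h
    · exact (support_indicator_subset).trans fun p hp => ⟨mem_univ _, hp.1⟩
  rw [IntegrableOn, Measure.volume_eq_prod, ← Measure.prod_restrict, Measure.restrict_univ,
    integrable_prod_iff' hmeas.aestronglyMeasurable]
  constructor
  · filter_upwards [ae_restrict_mem measurableSet_Ioo] with t ht
    simp only [hslice t ht]
    exact hint t
  · refine Integrable.of_bound (C := |c| * ((1 + 2 * L) * C) + B * ((|k| + |κ|) * C))
      hmeas.aestronglyMeasurable.norm.prod_swap.integral_prod_right' ?_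
    filter_upwards [ae_restrict_mem measurableSet_Ioo] with t ht
    have hh : 0 < β t - α t := sub_pos.2 (hlt t ht)
    rw [Real.norm_of_nonneg (integral_nonneg fun _ => norm_nonneg _)]
    simp only [hslice t ht, norm_indicator_eq_indicator_norm]
    rw [integral_indicator measurableSet_Ioo]
    have hle : ∀ z ∈ Ioo (α t) (β t), ‖cellIntegrand k κ φ c α β z t‖ ≤
        (|c| / (β t - α t)) * ((1 + 2 * L) * C) + (|k| + |κ|) * C := fun z hz =>
      abs_cellIntegrand_le hb (hα.abs_deriv_le t ht) (hβ.abs_deriv_le t ht) hz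
    have h1 := norm_setIntegral_le_of_norm_le_const (μ := volume) (s := Ioo (α t) (β t))
      (f := fun z => ‖cellIntegrand k κ φ c α β z t‖) (by simp)
      (fun z hz => by simpa using hle z hz)
    rw [Real.norm_of_nonneg (integral_nonneg fun _ => norm_nonneg _)] at h1
    refine h1.trans ?_
    rw [Measure.real, Real.volume_Ioo, ENNReal.toReal_ofReal hh.le, add_mul]
    refine add_le_add (le_of_eq ?_) ?_
    · field_simp
    · have hBt : β t - α t ≤ B := (le_abs_self _).trans (hB t (Ioo_subset_Icc_self ht))
      rw [mul_comm]
      gcongr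

theorem cellEnergy_nonneg {t : ℝ} (hφ : ∀ z, 0 ≤ φ (z, t)) : 0 ≤ cellEnergy k φ c α β t :=
  intervalIntegral.integral_nonneg zero_le_one fun _ _ => mul_nonneg (abs_nonneg _) (hφ _)

/-- In a cell of positive length, `cellEnergy` is the integral of `φ |v - k|`. -/
theorem cellEnergy_eq_integral {t : ℝ} (hlt : α t < β t) :
    cellEnergy k φ c α β t = ∫ z in (α t)..(β t), φ (z, t) * |c / (β t - α t) - k| := by
  have hh : 0 < β t - α t := sub_pos.2 hlt
  have hne := hh.ne'
  have hsub := intervalIntegral.integral_comp_add_mul (a := 0) (b := 1)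
    (fun z => φ (z, t) * |c / (β t - α t) - k|) hne (α t)
  simp only [mul_zero, add_zero, mul_one, add_sub_cancel, smul_eq_mul] at hsub
  have hv : c - k * (β t - α t) = (β t - α t) * (c / (β t - α t) - k) := by
    field_simp
  rw [eq_inv_mul_iff_mul_eq₀ hne, ← intervalIntegral.integral_const_mul] at hsub
  rw [← hsub, cellEnergy]
  refine intervalIntegral.integral_congr fun s _ => ?_
  simp only [hv, abs_mul, abs_of_pos hh, mul_comm (β t - α t) s]
  ring

end Cell

/-! ### One stage -/

/-- Summation by parts: the difference of the two sides is the sum of the terms in `h`. -/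
theorem sub_le_sum_mul_sub {s B : ℕ → ℝ} {m : ℕ}
    (h : ∀ i < m, 0 ≤ (s i - s (i + 1)) * B (i + 1)) :
    s m * B (m + 1) - s 0 * B 0 ≤ ∑ i ∈ Finset.range (m + 1), s i * (B (i + 1) - B i) := by
  induction m with
  | zero => simp [mul_sub]
  | succ m ih =>
    rw [Finset.sum_range_succ]
    have h1 := ih fun i hi => h i (by omega)
    have h2 := h m (by omega)
    nlinarith

theorem integral_eq_sum_integral_cells {F : ℝ → ℝ} {ξ : ℕ → ℝ} {m : ℕ} {G : ℕ → ℝ → ℝ}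
    (hξ : ∀ i < m, ξ i ≤ ξ (i + 1)) (hG : ∀ i < m, Continuous (G i))
    (hFG : ∀ i < m, EqOn F (G i) (Ioo (ξ i) (ξ (i + 1))))
    (hout : ∀ z, z ∉ Ioc (ξ 0) (ξ m) → F z = 0) :
    ∫ z, F z = ∑ i ∈ Finset.range m, ∫ z in (ξ i)..(ξ (i + 1)), G i z := by
  rw [← intervalIntegral.integral_eq_integral_of_support_subset (a := ξ 0) (b := ξ m)
    fun z hz => by_contra fun h => hz (hout z h),
    ← intervalIntegral.sum_integral_adjacent_intervals (a := ξ)]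
  · refine Finset.sum_congr rfl fun i hi => ?_
    have hi := Finset.mem_range.1 hi
    exact intervalIntegral.integral_congr_Ioo_of_le (hξ i hi) (hFG i hi)
  · intro i hi
    refine ((hG i hi).intervalIntegrable _ _).congr_uIoo ?_
    rw [uIoo_of_le (hξ i hi)]
    exact (hFG i hi).symm

theorem exists_mem_Ioo_of_ne {ξ : ℕ → ℝ} {m : ℕ} {z : ℝ} (hz : z ∈ Ioo (ξ 0) (ξ m))
    (hne : ∀ i ≤ m, z ≠ ξ i) : ∃ i < m, z ∈ Ioo (ξ i) (ξ (i + 1)) := by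
  induction m with
  | zero => exact absurd (hz.1.trans hz.2) (lt_irrefl _)
  | succ m ih =>
    rcases lt_or_gt_of_ne (hne m (by omega)) with h | h
    · obtain ⟨i, hi, hzi⟩ := ih ⟨hz.1, h⟩ fun i hi => hne i (by omega)
      exact ⟨i, by omega, hzi⟩
    · exact ⟨m, by omega, h, hz.2⟩

theorem measure_graph_eq_zero {α : ℝ → ℝ} (hα : Continuous α) :
    volume {p : ℝ × ℝ | p.1 = α p.2} = 0 := by
  have hm : MeasurableSet {p : ℝ × ℝ | p.1 = α p.2} :=
    measurableSet_eq_fun measurable_fst (hα.measurable.comp measurable_snd)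
  rw [Measure.volume_eq_prod, ← Measure.prod_swap, Measure.map_apply measurable_swap hm,
    Measure.measure_prod_null (measurable_swap hm)]
  refine Filter.Eventually.of_forall fun t => ?_
  simp

section Stage

variable {a b L k κ : ℝ} {φ : ℝ × ℝ → ℝ} {m : ℕ} {X : ℕ → ℝ → ℝ} {c : ℕ → ℝ} {F : ℝ → ℝ → ℝ}

/-- If an integrand agrees with the cell integrands between finitely many ordered paths, and
vanishes outside, then it is integrable on the time slab. -/
theorem integrableOn_of_cells (hφ : ContDiff ℝ ∞ φ) (hs : HasCompactSupport φ)
    (hX : ∀ i ≤ m, IsPath a b L (X i))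
    (hlt : ∀ t ∈ Ioo a b, ∀ i < m, X i t < X (i + 1) t)
    (hF : ∀ t ∈ Ioo a b, ∀ i < m, ∀ z ∈ Ioo (X i t) (X (i + 1) t),
      F z t = cellIntegrand k κ φ (c i) (X i) (X (i + 1)) z t)
    (hout : ∀ t ∈ Ioo a b, ∀ z, z ∉ Ioo (X 0 t) (X m t) → F z t = 0) :
    IntegrableOn (fun p : ℝ × ℝ => F p.1 p.2) (univ ×ˢ Ioo a b) volume := by
  -- The graphs of the nodes are null sets and the integrand vanishes outside the outermost nodes,
  -- so only the open cells matter.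
  have hcov : (univ ×ˢ Ioo a b : Set (ℝ × ℝ)) ⊆
      ((⋃ i ∈ Finset.range m, cellRegion a b (X i) (X (i + 1)))
        ∪ (⋃ i ∈ Finset.range (m + 1), {p : ℝ × ℝ | p.1 = X i p.2}))
        ∪ {p : ℝ × ℝ | p.2 ∈ Ioo a b ∧ p.1 ∉ Ioo (X 0 p.2) (X m p.2)} := by
    rintro ⟨z, t⟩ ⟨-, ht⟩
    by_cases hz : z ∈ Ioo (X 0 t) (X m t)
    · left
      by_cases hne : ∀ i ≤ m, z ≠ X i t
      · obtain ⟨i, hi, hzi⟩ := exists_mem_Ioo_of_ne (ξ := fun i => X i t) hz hne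
        exact Or.inl (mem_biUnion (Finset.mem_range.2 hi) ⟨ht, hzi⟩)
      · push Not at hne
        obtain ⟨i, hi, hzi⟩ := hne
        exact Or.inr (mem_biUnion (Finset.mem_range.2 (Nat.lt_succ_of_le hi)) hzi)
    · exact Or.inr ⟨ht, hz⟩
  refine IntegrableOn.mono_set ((IntegrableOn.union ?_ ?_).union ?_) hcov
  · rw [integrableOn_finset_iUnion]
    intro i hi
    have hi := Finset.mem_range.1 hi
    have hα := hX i hi.le
    have hβ := hX (i + 1) hi
    refine (integrableOn_cellIntegrand (k := k) (κ := κ) (c := c i) hφ hs hα hβ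
      fun t ht => hlt t ht i hi).congr_fun (fun p hp => ?_)
      (measurableSet_cellRegion hα.continuous hβ.continuous)
    exact (hF p.2 hp.1 i hi p.1 hp.2).symm
  · rw [integrableOn_finset_iUnion]
    intro i hi
    exact IntegrableOn.of_measure_zero
      (measure_graph_eq_zero (hX i (Nat.lt_succ_iff.1 (Finset.mem_range.1 hi))).continuous)
  · refine integrableOn_zero.congr_fun (fun p hp => (hout p.2 hp.1 p.1 hp.2).symm) ?_
    have h0 := hX 0 (Nat.zero_le m)
    have h1 := hX m le_rfl
    have hset : {p : ℝ × ℝ | p.2 ∈ Ioo a b ∧ p.1 ∉ Ioo (X 0 p.2) (X m p.2)} =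
        Prod.snd ⁻¹' Ioo a b \ cellRegion a b (X 0) (X m) := by
      ext p
      exact ⟨fun h => ⟨h.1, fun h' => h.2 h'.2⟩, fun h => ⟨h.1, fun h' => h.2 ⟨h.1, h'⟩⟩⟩
    rw [hset]
    exact (measurable_snd measurableSet_Ioo).diff
      (measurableSet_cellRegion h0.continuous h1.continuous)

/-- The entropy balance of a stage. -/
theorem sum_cellEnergy_sub_le (hab : a ≤ b) (hφ : ContDiff ℝ ∞ φ) (hs : HasCompactSupport φ)
    (hX : ∀ i ≤ m + 1, IsPath a b L (X i))
    (hlt : ∀ t ∈ Ioo a b, ∀ i < m + 1, X i t < X (i + 1) t)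
    (hF : ∀ t ∈ Ioo a b, ∀ i < m + 1, ∀ z ∈ Ioo (X i t) (X (i + 1) t),
      F z t = cellIntegrand k κ φ (c i) (X i) (X (i + 1)) z t)
    (hout : ∀ t ∈ Ioo a b, ∀ z, z ∉ Ioo (X 0 t) (X (m + 1) t) → F z t = 0)
    (hnode : ∀ t ∈ Ioo a b, ∀ i < m,
      0 ≤ (Real.sign (c i / (X (i + 1) t - X i t) - k)
        - Real.sign (c (i + 1) / (X (i + 2) t - X (i + 1) t) - k)) * nodeFlux k κ φ (X (i + 1)) t)
    (hleft : ∀ t ∈ Ioo a b, nodeFlux k κ φ (X 0) t = 0)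
    (hright : ∀ t ∈ Ioo a b, nodeFlux k κ φ (X (m + 1)) t = 0) :
    ∑ i ∈ Finset.range (m + 1), cellEnergy k φ (c i) (X i) (X (i + 1)) b
      - ∑ i ∈ Finset.range (m + 1), cellEnergy k φ (c i) (X i) (X (i + 1)) a
      ≤ ∫ t in a..b, ∫ z, F z t := by
  have hrate : ∀ i ∈ Finset.range (m + 1), IntervalIntegrable
      (fun t => ∫ s in (0 : ℝ)..1, cellRate k φ (c i) (X i) (X (i + 1)) s t) volume a b :=
    fun i hi => by
      have hi := Finset.mem_range.1 hi
      exact intervalIntegrable_integral_cellRate hab hφ hs (hX i hi.le) (hX (i + 1) hi)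
  have hflux : ∀ i ∈ Finset.range (m + 1), IntervalIntegrable
      (fun t => Real.sign (c i / (X (i + 1) t - X i t) - k)
        * (nodeFlux k κ φ (X (i + 1)) t - nodeFlux k κ φ (X i) t)) volume a b :=
    fun i hi => by
      have hi := Finset.mem_range.1 hi
      exact intervalIntegrable_sign_mul_nodeFlux hab hφ hs (hX i hi.le) (hX (i + 1) hi)
  have hslice : ∀ t ∈ Ioo a b, ∫ z, F z t =
      (∑ i ∈ Finset.range (m + 1), ∫ s in (0 : ℝ)..1, cellRate k φ (c i) (X i) (X (i + 1)) s t)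
      + ∑ i ∈ Finset.range (m + 1), Real.sign (c i / (X (i + 1) t - X i t) - k)
        * (nodeFlux k κ φ (X (i + 1)) t - nodeFlux k κ φ (X i) t) := by
    intro t ht
    rw [integral_eq_sum_integral_cells (ξ := fun i => X i t)
      (G := fun i z => cellIntegrand k κ φ (c i) (X i) (X (i + 1)) z t)
      (fun i hi => (hlt t ht i hi).le) (fun i _ => continuous_cellIntegrand_fst hφ t)
      (fun i hi z hz => hF t ht i hi z hz)
      (fun z hz => hout t ht z fun h => hz (Ioo_subset_Ioc_self h)), ← Finset.sum_add_distrib]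
    refine Finset.sum_congr rfl fun i hi => ?_
    exact integral_cellIntegrand hφ (hlt t ht i (Finset.mem_range.1 hi))
  have hpos : 0 ≤ ∫ t in a..b, ∑ i ∈ Finset.range (m + 1),
      Real.sign (c i / (X (i + 1) t - X i t) - k)
        * (nodeFlux k κ φ (X (i + 1)) t - nodeFlux k κ φ (X i) t) := by
    rw [intervalIntegral.integral_of_le hab, integral_Ioc_eq_integral_Ioo]
    refine setIntegral_nonneg measurableSet_Ioo fun t ht => ?_
    have := sub_le_sum_mul_sub (s := fun i => Real.sign (c i / (X (i + 1) t - X i t) - k))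
      (B := fun i => nodeFlux k κ φ (X i) t) (m := m) (hnode t ht)
    simpa only [hleft t ht, hright t ht, mul_zero, sub_zero] using this
  have hrate' := IntervalIntegrable.sum _ hrate
  have hflux' := IntervalIntegrable.sum _ hflux
  rw [Finset.sum_fn] at hrate' hflux'
  rw [intervalIntegral.integral_congr_Ioo_of_le hab hslice,
    intervalIntegral.integral_add hrate' hflux',
    intervalIntegral.integral_finsetSum hrate, ← Finset.sum_sub_distrib]
  refine (le_of_eq (Finset.sum_congr rfl fun i hi => ?_)).trans (le_add_of_nonneg_right hpos)
  have hi := Finset.mem_range.1 hi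
  exact (integral_integral_cellRate hab hφ hs (hX i hi.le) (hX (i + 1) hi)).symm

end Stage

/-! ### The entropic velocity -/

section Velocity

variable {f : ℝ → ℝ} {L : ℝ≥0}

/-- As `f 0 = 0`, `a` is the difference quotient of `f` at `0`. The bound makes the infima and
suprema in `velocity` meaningful and limits the particle speeds. -/
theorem abs_speed_le (hf : LipschitzWith L f) (h0 : f 0 = 0) (u : ℝ) : |speed f u| ≤ L := by
  unfold speed
  split_ifs with hu
  · exact norm_deriv_le_of_lipschitz hf
  · have := hf.norm_sub_le u 0
    rw [h0, sub_zero, sub_zero, Real.norm_eq_abs, Real.norm_eq_abs] at this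
    rwa [abs_div, div_le_iff₀ (abs_pos.2 hu)]

theorem bddBelow_speed_image (hf : LipschitzWith L f) (h0 : f 0 = 0) (s : Set ℝ) :
    BddBelow (speed f '' s) :=
  ⟨-L, by rintro _ ⟨u, -, rfl⟩; exact (abs_le.1 (abs_speed_le hf h0 u)).1⟩

theorem bddAbove_speed_image (hf : LipschitzWith L f) (h0 : f 0 = 0) (s : Set ℝ) :
    BddAbove (speed f '' s) :=
  ⟨L, by rintro _ ⟨u, -, rfl⟩; exact (abs_le.1 (abs_speed_le hf h0 u)).2⟩

theorem abs_velocity_le (hf : LipschitzWith L f) (h0 : f 0 = 0) (l r : ℝ) :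
    |velocity f l r| ≤ L := by
  unfold velocity
  split_ifs with h
  · have hl : l ∈ Icc l r := left_mem_Icc.2 h
    refine abs_le.2 ⟨le_csInf ⟨_, mem_image_of_mem _ hl⟩ ?_, ?_⟩
    · rintro _ ⟨u, -, rfl⟩; exact (abs_le.1 (abs_speed_le hf h0 u)).1
    · exact (csInf_le (bddBelow_speed_image hf h0 _) (mem_image_of_mem _ hl)).trans
        (abs_le.1 (abs_speed_le hf h0 l)).2
  · have hl : l ∈ Icc r l := right_mem_Icc.2 (not_le.1 h).le
    refine abs_le.2 ⟨?_, csSup_le ⟨_, mem_image_of_mem _ hl⟩ ?_⟩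
    · exact (abs_le.1 (abs_speed_le hf h0 l)).1.trans
        (le_csSup (bddAbove_speed_image hf h0 _) (mem_image_of_mem _ hl))
    · rintro _ ⟨u, -, rfl⟩; exact (abs_le.1 (abs_speed_le hf h0 u)).2

theorem realSign_mono : Monotone Real.sign := by
  intro x y hxy
  rcases lt_trichotomy x 0 with hx | hx | hx
  · rw [Real.sign_of_neg hx]
    exact (abs_le.1 (abs_realSign_le y)).1
  · rcases eq_or_lt_of_le (hx ▸ hxy) with hy | hy
    · rw [hx, ← hy]
    · rw [hx, Real.sign_zero, Real.sign_of_pos hy]; exact zero_le_one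
  · rw [Real.sign_of_pos hx, Real.sign_of_pos (hx.trans_le hxy)]

/-- The velocity `V` is entropic: the entropy produced at a discontinuity has the right sign. -/
theorem sign_sub_sign_mul_nonneg (hf : LipschitzWith L f) (h0 : f 0 = 0) {k : ℝ} (hk : 0 ≤ k)
    (l r : ℝ) :
    0 ≤ (Real.sign (l - k) - Real.sign (r - k)) * (k * velocity f l r - f k) := by
  have hfk : f k = k * speed f k := by
    unfold speed
    split_ifs with h
    · rw [h, h0, zero_mul]
    · field_simp
  -- The second factor becomes `k (V - a(k))`. If `k` lies between `l` and `r`, the extremum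
  -- defining `V` compares it with `a(k)` in the direction matching the signs; otherwise the two
  -- signs agree and the product is zero.
  rw [hfk, ← mul_sub]
  unfold velocity
  split_ifs with h
  · have h1 := realSign_mono (sub_le_sub_right h k)
    by_cases hm : k ∈ Icc l r
    · have h2 := csInf_le (bddBelow_speed_image hf h0 _) (mem_image_of_mem (speed f) hm)
      exact mul_nonneg_of_nonpos_of_nonpos (sub_nonpos.2 h1)
        (mul_nonpos_of_nonneg_of_nonpos hk (sub_nonpos.2 h2))
    · have : Real.sign (l - k) = Real.sign (r - k) := by
        rcases lt_or_ge k l with hkl | hkl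
        · rw [Real.sign_of_pos (sub_pos.2 hkl), Real.sign_of_pos (sub_pos.2 (hkl.trans_le h))]
        · have hkr : r < k := not_le.1 fun h' => hm ⟨hkl, h'⟩
          rw [Real.sign_of_neg (sub_neg.2 (h.trans_lt hkr)), Real.sign_of_neg (sub_neg.2 hkr)]
      rw [this, sub_self, zero_mul]
  · have h := (not_le.1 h).le
    have h1 := realSign_mono (sub_le_sub_right h k)
    by_cases hm : k ∈ Icc r l
    · have h2 := le_csSup (bddAbove_speed_image hf h0 _) (mem_image_of_mem (speed f) hm)
      exact mul_nonneg (sub_nonneg.2 h1) (mul_nonneg hk (sub_nonneg.2 h2))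
    · have : Real.sign (l - k) = Real.sign (r - k) := by
        rcases lt_or_ge k r with hkl | hkl
        · rw [Real.sign_of_pos (sub_pos.2 hkl), Real.sign_of_pos (sub_pos.2 (hkl.trans_le h))]
        · have hkr : l < k := not_le.1 fun h' => hm ⟨hkl, h'⟩
          rw [Real.sign_of_neg (sub_neg.2 (h.trans_lt hkr)), Real.sign_of_neg (sub_neg.2 hkr)]
      rw [this, sub_self, zero_mul]

end Velocity

/-! ### Cells between ordered nodes -/

theorem nodes_le {ξ : ℕ → ℝ} {m : ℕ} (hξ : ∀ i < m, ξ i ≤ ξ (i + 1)) {l l' : ℕ} (h : l ≤ l')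
    (h' : l' ≤ m) : ξ l ≤ ξ l' := by
  induction l', h using Nat.le_induction with
  | base => exact le_rfl
  | succ i _ ih => exact (ih (by omega)).trans (hξ i (by omega))

/-- A sum over cells, evaluated at a point of the open cell `i`. -/
theorem sum_indicator_cells {ξ : ℕ → ℝ} {m i n : ℕ} {z : ℝ} (hξ : ∀ i < m, ξ i ≤ ξ (i + 1))
    (hi : i < m) (hz : z ∈ Ioo (ξ i) (ξ (i + 1))) (hn : n ≤ m) {S : ℕ → Set ℝ}
    (hS : ∀ l, Ioo (ξ l) (ξ (l + 1)) ⊆ S l) (hS' : ∀ l, S l ⊆ Ico (ξ l) (ξ (l + 1)))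
    (g : ℕ → ℝ → ℝ) :
    ∑ l ∈ Finset.Ico 1 n, (S l).indicator (g l) z = if 1 ≤ i ∧ i < n then g i z else 0 := by
  have hzero : ∀ l ∈ Finset.Ico 1 n, l ≠ i → (S l).indicator (g l) z = 0 := by
    intro l hl hli
    refine indicator_of_notMem (fun hzl => ?_) _
    have hzl := hS' l hzl
    have hln := (Finset.mem_Ico.1 hl).2
    rcases lt_or_gt_of_ne hli with h | h
    · exact absurd (hzl.2.trans_le (nodes_le hξ (Nat.succ_le_of_lt h) hi.le)) hz.1.not_gt
    · exact absurd (hz.2.trans_le (nodes_le hξ (Nat.succ_le_of_lt h) (by omega))) hzl.1.not_gt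
  split_ifs with h
  · rw [Finset.sum_eq_single_of_mem i (Finset.mem_Ico.2 h) hzero, indicator_of_mem (hS i hz)]
  · exact Finset.sum_eq_zero fun l hl => hzero l hl fun hli => h (hli ▸ Finset.mem_Ico.1 hl)

/-- The bound `R ≤ |z|` is not strict, so that artificial nodes placed exactly at `±R` carry no
flux. -/
theorem exists_radius {φ : ℝ × ℝ → ℝ} (hφ : ContDiff ℝ ∞ φ) (hs : HasCompactSupport φ) :
    ∃ R : ℝ, ∀ z t : ℝ, R ≤ |z| → φ (z, t) = 0 ∧ deriv (fun q => φ (q, t)) z = 0 ∧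
      deriv (fun s => φ (z, s)) t = 0 := by
  have key : ∀ g : ℝ × ℝ → ℝ, HasCompactSupport g → ∃ R : ℝ, ∀ z t : ℝ, R ≤ |z| → g (z, t) = 0 := by
    intro g hg
    obtain ⟨R, hR⟩ := hg.isCompact.isBounded.subset_ball (0 : ℝ × ℝ)
    refine ⟨R, fun z t hz => image_eq_zero_of_notMem_tsupport fun hmem => ?_⟩
    have h1 := mem_ball_zero_iff.1 (hR hmem)
    exact absurd ((norm_fst_le ((z, t) : ℝ × ℝ)).trans_lt h1) (not_lt.2 hz)
  obtain ⟨R₀, h₀⟩ := key _ hs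
  obtain ⟨R₁, h₁⟩ := key _ (hasCompactSupport_deriv_fst hφ hs)
  obtain ⟨R₂, h₂⟩ := key _ (hasCompactSupport_deriv_snd hφ hs)
  refine ⟨max R₀ (max R₁ R₂), fun z t hz => ?_⟩
  simp only [max_le_iff] at hz
  exact ⟨h₀ z t hz.1, h₁ z t hz.2.1, h₂ z t hz.2.2⟩

theorem integrable_mul_abs_sum_indicator_sub {φ : ℝ × ℝ → ℝ} (hφ : ContDiff ℝ ∞ φ)
    (hs : HasCompactSupport φ) (t k : ℝ) (s : Finset ℕ) (A B d : ℕ → ℝ) :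
    Integrable fun z => φ (z, t) *
      |∑ i ∈ s, (Ioo (A i) (B i)).indicator (fun _ => d i) z - k| := by
  obtain ⟨R, hR⟩ := exists_radius hφ hs
  have h1 : Integrable fun z => φ (z, t) := by
    refine Continuous.integrable_of_hasCompactSupport
      (hφ.continuous.comp (continuous_id.prodMk continuous_const))
      (HasCompactSupport.intro (isCompact_Icc (a := -R) (b := R)) fun z hz => (hR z t ?_).1)
    by_contra h
    exact hz ⟨(abs_lt.1 (not_le.1 h)).1.le, (abs_lt.1 (not_le.1 h)).2.le⟩
  refine h1.mul_bdd (c := (∑ i ∈ s, |d i|) + |k|) ?_ (Filter.Eventually.of_forall fun z => ?_)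
  · exact (((Finset.measurable_sum _ fun i _ =>
      measurable_const.indicator measurableSet_Ioo).sub_const k).abs).aestronglyMeasurable
  · rw [Real.norm_eq_abs, abs_abs]
    refine (abs_sub _ _).trans (add_le_add_left ((Finset.abs_sum_le_sum_abs _ _).trans
      (Finset.sum_le_sum fun i _ => ?_)) _)
    by_cases hz : z ∈ Ioo (A i) (B i)
    · rw [indicator_of_mem hz]
    · rw [indicator_of_notMem hz, abs_zero]; exact abs_nonneg _

/-! ### Runs of the scheme -/

namespace Run

/-- The approximate solution computed from the data of stage `j`. -/
def stageApprox (D : Run) (j : ℕ) (z t : ℝ) : ℝ :=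
  ∑ i ∈ Finset.Ico 1 (D.n j),
    (Ioo (D.x j i t) (D.x j (i + 1) t)).indicator (fun _ => D.density j i t) z

/-- The entropy integrand computed from the data of stage `j`. -/
def stageIntegrand (f : ℝ → ℝ) (D : Run) (k : ℝ) (φ : ℝ × ℝ → ℝ) (j : ℕ) (z t : ℝ) : ℝ :=
  |D.stageApprox j z t - k| * deriv (fun s => φ (z, s)) t
  + (D.stageField f j z t * D.stageApprox j z t - f k) * Real.sign (D.stageApprox j z t - k)
      * deriv (fun q => φ (q, t)) z

/-- The weighted entropy at time `t`, computed from the data of stage `j`. -/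
def stageEnergy (D : Run) (k : ℝ) (φ : ℝ × ℝ → ℝ) (j : ℕ) (t : ℝ) : ℝ :=
  ∫ z, φ (z, t) * |D.stageApprox j z t - k|

/-- The mass of the cell `i` in stage `j`. -/
def cellMass (D : Run) (j i : ℕ) : ℝ :=
  if 1 ≤ i ∧ i < D.n j then (D.x j (i + 1) (D.τ j) - D.x j i (D.τ j)) * D.w j i else 0

/-- The particle paths of stage `j`, continued by constants to all times, with two motionless
nodes at `-R` and `R`. -/
def node (D : Run) (R : ℝ) (j i : ℕ) (t : ℝ) : ℝ :=
  if i = 0 then -R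
  else if i ≤ D.n j then D.x j i (max (D.τ j) (min (D.τ (j + 1)) t)) else R

variable {f u₀ : ℝ → ℝ} {N : ℕ} {y : ℕ → ℝ} {T : ℝ} {D : Run} {R : ℝ} {j : ℕ}

theorem node_zero (t : ℝ) : D.node R j 0 t = -R := rfl

theorem node_last (t : ℝ) : D.node R j (D.n j + 1) t = R := by simp [node]

theorem node_eq {i : ℕ} (hi : i ∈ Icc 1 (D.n j)) {t : ℝ}
    (ht : t ∈ Icc (D.τ j) (D.τ (j + 1))) : D.node R j i t = D.x j i t := by
  rw [node, if_neg (Nat.one_le_iff_ne_zero.1 hi.1), if_pos hi.2, min_eq_right ht.2,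
    max_eq_right ht.1]

/-- Outer cells are covered because their mass is zero. In a collapsed cell both sides are `0` by
the convention for division by zero. -/
theorem density_eq (i : ℕ) {t : ℝ} (ht : t ∈ Icc (D.τ j) (D.τ (j + 1))) :
    D.density j i t = D.cellMass j i / (D.node R j (i + 1) t - D.node R j i t) := by
  unfold density cellMass
  split_ifs with h
  · rw [node_eq ⟨h.1, h.2.le⟩ ht, node_eq ⟨by omega, h.2⟩ ht, div_mul_eq_mul_div]
  · rw [zero_div]

namespace IsOutput

theorem x_le (hD : IsOutput f u₀ N y T D) {t : ℝ} (hj : j ≤ D.m) (ht : t ∈ Icc (D.τ j) (D.τ (j + 1))) {i : ℕ}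
    (hi : i ∈ Ico 1 (D.n j)) : D.x j i t ≤ D.x j (i + 1) t := by
  have hlt := hD.time_lt j hj
  rw [← closure_Ico hlt.ne] at ht
  have hcl := fun l hl => (hD.continuousOn j hj l hl t
    (by rwa [closure_Ico hlt.ne] at ht)).mono Ico_subset_Icc_self
  exact ContinuousWithinAt.closure_le ht (hcl i ⟨hi.1, hi.2.le⟩) (hcl (i + 1) ⟨by simp, hi.2⟩)
    fun r hr => (hD.ordered j hj r hr i hi).le

/-- The rightmost particle survives every collision. -/
theorem n_pos (hD : IsOutput f u₀ N y T D) (hN : 1 ≤ N) (hj : j ≤ D.m) : 1 ≤ D.n j := by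
  induction j with
  | zero => rwa [hD.number_zero]
  | succ j ih =>
    obtain ⟨π, -, himg, -, -⟩ := hD.restart j hj
    have hmem : D.n j ∈ D.survivors j := ⟨⟨ih (by omega), le_rfl⟩, Or.inl rfl⟩
    rw [← himg] at hmem
    obtain ⟨i, hi, -⟩ := hmem
    exact hi.1.trans hi.2

end IsOutput

/-- The particles of stage `j` stay in `(-R, R)`. -/
def Confined (D : Run) (R : ℝ) (j : ℕ) : Prop :=
  ∀ i ∈ Icc 1 (D.n j), ∀ t ∈ Icc (D.τ j) (D.τ (j + 1)), |D.x j i t| < R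

namespace IsOutput

theorem exists_confined (hD : IsOutput f u₀ N y T D) (hj : j ≤ D.m) (R₀ : ℝ) :
    ∃ R, R₀ ≤ R ∧ D.Confined R j := by
  have h : ∀ i : ℕ, ∃ B : ℝ, i ∈ Icc 1 (D.n j) →
      ∀ t ∈ Icc (D.τ j) (D.τ (j + 1)), |D.x j i t| ≤ B := fun i => by
    by_cases hi : i ∈ Icc 1 (D.n j)
    · obtain ⟨B, hB⟩ := isCompact_Icc.exists_bound_of_continuousOn (hD.continuousOn j hj i hi)
      exact ⟨B, fun _ => hB⟩
    · exact ⟨0, fun h => absurd h hi⟩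
  choose B hB using h
  refine ⟨max R₀ (∑ i ∈ Finset.Icc 1 (D.n j), |B i| + 1), le_max_left _ _, fun i hi t ht => ?_⟩
  have h1 := Finset.single_le_sum (f := fun i => |B i|) (fun i _ => abs_nonneg _)
    (Finset.mem_Icc.2 hi)
  have h2 := (hB i hi t ht).trans (le_abs_self _)
  exact lt_of_lt_of_le (by linarith) (le_max_right _ _)

theorem node_le (hD : IsOutput f u₀ N y T D) (hN : 1 ≤ N) (hj : j ≤ D.m) (hR : D.Confined R j)
    {t : ℝ} (ht : t ∈ Icc (D.τ j) (D.τ (j + 1))) {i : ℕ} (hi : i < D.n j + 1) :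
    D.node R j i t ≤ D.node R j (i + 1) t := by
  have hn := hD.n_pos hN hj
  rcases Nat.eq_zero_or_pos i with rfl | hi0
  · rw [node_zero, node_eq ⟨le_rfl, hn⟩ ht]
    exact (abs_lt.1 (hR 1 ⟨le_rfl, hn⟩ t ht)).1.le
  · rcases eq_or_lt_of_le (Nat.lt_succ_iff.1 hi) with rfl | hin
    · rw [node_last, node_eq ⟨hn, le_rfl⟩ ht]
      exact (abs_lt.1 (hR _ ⟨hn, le_rfl⟩ t ht)).2.le
    · rw [node_eq ⟨hi0, hin.le⟩ ht, node_eq ⟨by omega, hin⟩ ht]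
      exact hD.x_le hj ht ⟨hi0, hin⟩

theorem node_lt (hD : IsOutput f u₀ N y T D) (hN : 1 ≤ N) (hj : j ≤ D.m) (hR : D.Confined R j)
    {t : ℝ} (ht : t ∈ Ico (D.τ j) (D.τ (j + 1))) {i : ℕ} (hi : i < D.n j + 1) :
    D.node R j i t < D.node R j (i + 1) t := by
  have hn := hD.n_pos hN hj
  have ht' := Ico_subset_Icc_self ht
  rcases Nat.eq_zero_or_pos i with rfl | hi0
  · rw [node_zero, node_eq ⟨le_rfl, hn⟩ ht']
    exact (abs_lt.1 (hR 1 ⟨le_rfl, hn⟩ t ht')).1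
  · rcases eq_or_lt_of_le (Nat.lt_succ_iff.1 hi) with rfl | hin
    · rw [node_last, node_eq ⟨hn, le_rfl⟩ ht']
      exact (abs_lt.1 (hR _ ⟨hn, le_rfl⟩ t ht')).2
    · rw [node_eq ⟨hi0, hin.le⟩ ht', node_eq ⟨by omega, hin⟩ ht']
      exact hD.ordered j hj t ht i ⟨hi0, hin⟩

theorem hasDerivAt_node (hD : IsOutput f u₀ N y T D) (hj : j ≤ D.m) {i : ℕ}
    (hi : i ∈ Icc 1 (D.n j)) {t : ℝ} (ht : t ∈ Ioo (D.τ j) (D.τ (j + 1))) :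
    HasDerivAt (D.node R j i) (D.nodeVelocity f j i t) t := by
  refine (hD.ode j hj i hi t ht).congr_of_eventuallyEq ?_
  filter_upwards [isOpen_Ioo.mem_nhds ht] with s hs
  exact node_eq hi (Ioo_subset_Icc_self hs)

theorem isPath_node {L : ℝ≥0} (hf : LipschitzWith L f) (h0 : f 0 = 0)
    (hD : IsOutput f u₀ N y T D) (hj : j ≤ D.m) (i : ℕ) :
    IsPath (D.τ j) (D.τ (j + 1)) L (D.node R j i) := by
  have hconst : ∀ C : ℝ, D.node R j i = (fun _ => C) →
      IsPath (D.τ j) (D.τ (j + 1)) L (D.node R j i) := fun C hC => by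
    rw [hC]
    exact ⟨continuous_const, fun t _ => differentiableAt_const _, fun t _ => by simp⟩
  by_cases hi0 : i = 0
  · exact hconst (-R) (by ext t; rw [hi0, node_zero])
  by_cases hin : i ≤ D.n j
  · have hi : i ∈ Icc 1 (D.n j) := ⟨Nat.one_le_iff_ne_zero.2 hi0, hin⟩
    refine ⟨?_, fun t ht => (hD.hasDerivAt_node hj hi ht).differentiableAt, fun t ht => ?_⟩
    · have heq : D.node R j i =
          D.x j i ∘ fun t => max (D.τ j) (min (D.τ (j + 1)) t) := by
        ext t; simp [node, hi0, hin]
      rw [heq]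
      exact (hD.continuousOn j hj i hi).comp_continuous (by fun_prop) fun t =>
        ⟨le_max_left _ _, max_le (hD.time_lt j hj).le (min_le_left _ _)⟩
    · rw [(hD.hasDerivAt_node hj hi ht).deriv]
      exact abs_velocity_le hf h0 _ _
  · exact hconst R (by ext t; simp [node, hi0, hin])

/-- In the open cell `i`, the approximate solution is the local density. -/
theorem stageApprox_eq (hD : IsOutput f u₀ N y T D) (hN : 1 ≤ N) (hj : j ≤ D.m)
    (hR : D.Confined R j) {t : ℝ} (ht : t ∈ Icc (D.τ j) (D.τ (j + 1))) {i : ℕ}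
    (hi : i < D.n j + 1) {z : ℝ} (hz : z ∈ Ioo (D.node R j i t) (D.node R j (i + 1) t)) :
    D.stageApprox j z t = D.density j i t := by
  have h1 := sum_indicator_cells (ξ := fun i => D.node R j i t)
    (fun i hi => hD.node_le hN hj hR ht hi) hi hz (Nat.le_succ (D.n j))
    (fun l => Subset.rfl) (fun l => Ioo_subset_Ico_self) (fun l _ => D.density j l t)
  have h2 : D.stageApprox j z t = if 1 ≤ i ∧ i < D.n j then D.density j i t else 0 := by
    rw [← h1]
    refine Finset.sum_congr rfl fun l hl => ?_
    have hl := Finset.mem_Ico.1 hl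
    rw [node_eq ⟨hl.1, hl.2.le⟩ ht, node_eq ⟨by omega, hl.2⟩ ht]
  rw [h2]
  split_ifs with h
  · rfl
  · rw [density, if_neg h]

/-- In the open cell between two particles, the velocity field is linear. -/
theorem stageField_eq (hD : IsOutput f u₀ N y T D) (hN : 1 ≤ N) (hj : j ≤ D.m)
    (hR : D.Confined R j) {t : ℝ} (ht : t ∈ Icc (D.τ j) (D.τ (j + 1))) {i : ℕ}
    (hi : i ∈ Ico 1 (D.n j)) {z : ℝ} (hz : z ∈ Ioo (D.x j i t) (D.x j (i + 1) t)) :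
    D.stageField f j z t =
      (D.x j (i + 1) t - z) / (D.x j (i + 1) t - D.x j i t) * D.nodeVelocity f j i t
      + (z - D.x j i t) / (D.x j (i + 1) t - D.x j i t) * D.nodeVelocity f j (i + 1) t := by
  have hn := hD.n_pos hN hj
  have hξ : ∀ i < D.n j + 1, D.node R j i t ≤ D.node R j (i + 1) t :=
    fun i hi => hD.node_le hN hj hR ht hi
  have hi1 : i ∈ Icc 1 (D.n j) := ⟨hi.1, hi.2.le⟩
  have hi2 : i + 1 ∈ Icc 1 (D.n j) := ⟨by simp, hi.2⟩
  have hz' : z ∈ Ioo (D.node R j i t) (D.node R j (i + 1) t) := by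
    rwa [node_eq hi1 ht, node_eq hi2 ht]
  have h1 := sum_indicator_cells (ξ := fun i => D.node R j i t) hξ (hi.2.trans (Nat.lt_succ_self _))
    hz' (Nat.le_succ (D.n j)) (fun l => Ioo_subset_Ico_self) (fun l => Subset.rfl)
    (fun l z => (D.x j (l + 1) t - z) / (D.x j (l + 1) t - D.x j l t) * D.nodeVelocity f j l t
      + (z - D.x j l t) / (D.x j (l + 1) t - D.x j l t) * D.nodeVelocity f j (l + 1) t)
  rw [if_pos (show 1 ≤ i ∧ i < D.n j from hi)] at h1
  have hl : D.x j 1 t ≤ D.x j i t := by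
    have := nodes_le hξ hi.1 (hi1.2.trans (Nat.le_succ _))
    rwa [node_eq hi1 ht, node_eq ⟨le_rfl, hn⟩ ht] at this
  have hr : D.x j (i + 1) t ≤ D.x j (D.n j) t := by
    have := nodes_le hξ hi2.2 (Nat.le_succ _)
    rwa [node_eq hi2 ht, node_eq ⟨hn, le_rfl⟩ ht] at this
  rw [stageField, indicator_of_notMem (fun h : z ∈ Iio (D.x j 1 t) => by
      exact absurd (hl.trans_lt hz.1) (not_lt.2 (le_of_lt h))),
    indicator_of_notMem (fun h : z ∈ Ici (D.x j (D.n j) t) => by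
      exact absurd (hz.2.trans_le hr) (not_lt.2 h)), zero_add, add_zero, ← h1]
  refine Finset.sum_congr rfl fun l hl => ?_
  have hl := Finset.mem_Ico.1 hl
  rw [node_eq ⟨hl.1, hl.2.le⟩ ht, node_eq ⟨by omega, hl.2⟩ ht]

theorem stageIntegrand_eq (hD : IsOutput f u₀ N y T D) (hN : 1 ≤ N) (hj : j ≤ D.m)
    (hR : D.Confined R j) {k : ℝ} {φ : ℝ × ℝ → ℝ} {t : ℝ} (ht : t ∈ Ioo (D.τ j) (D.τ (j + 1)))
    {i : ℕ} (hi : i < D.n j + 1) {z : ℝ}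
    (hz : z ∈ Ioo (D.node R j i t) (D.node R j (i + 1) t)) :
    D.stageIntegrand f k φ j z t =
      cellIntegrand k (f k) φ (D.cellMass j i) (D.node R j i) (D.node R j (i + 1)) z t := by
  have ht' := Ioo_subset_Icc_self ht
  rw [stageIntegrand, cellIntegrand, hD.stageApprox_eq hN hj hR ht' hi hz, ← density_eq i ht']
  by_cases h : i ∈ Ico 1 (D.n j)
  · have hi1 : i ∈ Icc 1 (D.n j) := ⟨h.1, h.2.le⟩
    have hi2 : i + 1 ∈ Icc 1 (D.n j) := ⟨by simp, h.2⟩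
    rw [(hD.hasDerivAt_node hj hi1 ht).deriv, (hD.hasDerivAt_node hj hi2 ht).deriv]
    rw [node_eq hi1 ht', node_eq hi2 ht'] at hz ⊢
    rw [hD.stageField_eq hN hj hR ht' h hz]
  -- In the two outer cells the interpolation towards the motionless nodes differs in general from
  -- the constant extension of `A`, but the velocity is multiplied by a zero density.
  · have : D.density j i t = 0 := if_neg h
    rw [this, mul_zero, mul_zero]

theorem stageEnergy_eq_sum (hD : IsOutput f u₀ N y T D) (hN : 1 ≤ N) (hj : j ≤ D.m)
    (hR : D.Confined R j) {k : ℝ} {φ : ℝ × ℝ → ℝ} (hφ : ContDiff ℝ ∞ φ)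
    (hR' : ∀ z t : ℝ, R ≤ |z| → φ (z, t) = 0) {t : ℝ} (ht : t ∈ Icc (D.τ j) (D.τ (j + 1))) :
    D.stageEnergy k φ j t = ∑ i ∈ Finset.range (D.n j + 1),
      ∫ z in (D.node R j i t)..(D.node R j (i + 1) t),
        φ (z, t) * |D.cellMass j i / (D.node R j (i + 1) t - D.node R j i t) - k| := by
  refine integral_eq_sum_integral_cells (ξ := fun i => D.node R j i t)
    (G := fun i z => φ (z, t) *
      |D.cellMass j i / (D.node R j (i + 1) t - D.node R j i t) - k|)
    (fun i hi => hD.node_le hN hj hR ht hi) (fun i _ => ?_) (fun i hi z hz => ?_) fun z hz => ?_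
  · have := hφ.continuous
    fun_prop
  · simp only [hD.stageApprox_eq hN hj hR ht hi hz, density_eq i ht (R := R)]
  · rw [hR' z t, zero_mul]
    by_contra h
    have h := abs_lt.1 (not_le.1 h)
    rw [node_zero, node_last] at hz
    exact hz ⟨h.1, h.2.le⟩

theorem stageEnergy_start (hD : IsOutput f u₀ N y T D) (hN : 1 ≤ N) (hj : j ≤ D.m)
    (hR : D.Confined R j) {k : ℝ} {φ : ℝ × ℝ → ℝ} (hφ : ContDiff ℝ ∞ φ)
    (hR' : ∀ z t : ℝ, R ≤ |z| → φ (z, t) = 0) :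
    D.stageEnergy k φ j (D.τ j) = ∑ i ∈ Finset.range (D.n j + 1),
      cellEnergy k φ (D.cellMass j i) (D.node R j i) (D.node R j (i + 1)) (D.τ j) := by
  have hlt := hD.time_lt j hj
  rw [hD.stageEnergy_eq_sum hN hj hR hφ hR' (left_mem_Icc.2 hlt.le)]
  exact Finset.sum_congr rfl fun i hi => (cellEnergy_eq_integral
    (hD.node_lt hN hj hR (left_mem_Ico.2 hlt) (Finset.mem_range.1 hi))).symm

/-- Cells that collapse at the end of a stage can only lose entropy. -/
theorem stageEnergy_end_le (hD : IsOutput f u₀ N y T D) (hN : 1 ≤ N) (hj : j ≤ D.m)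
    (hR : D.Confined R j) {k : ℝ} {φ : ℝ × ℝ → ℝ} (hφ : ContDiff ℝ ∞ φ)
    (hφ0 : ∀ z, 0 ≤ φ (z, D.τ (j + 1))) (hR' : ∀ z t : ℝ, R ≤ |z| → φ (z, t) = 0) :
    D.stageEnergy k φ j (D.τ (j + 1)) ≤ ∑ i ∈ Finset.range (D.n j + 1),
      cellEnergy k φ (D.cellMass j i) (D.node R j i) (D.node R j (i + 1)) (D.τ (j + 1)) := by
  have ht := right_mem_Icc.2 (hD.time_lt j hj).le
  rw [hD.stageEnergy_eq_sum hN hj hR hφ hR' ht]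
  refine Finset.sum_le_sum fun i hi => ?_
  -- A collapsed cell gives `0` on the left and a nonnegative `cellEnergy` on the right; the other
  -- cells give equality.
  rcases (hD.node_le hN hj hR ht (Finset.mem_range.1 hi)).eq_or_lt with h | h
  · rw [← h, intervalIntegral.integral_same]
    exact cellEnergy_nonneg hφ0
  · exact (cellEnergy_eq_integral h).ge

/-- The entropy inequality in one stage. -/
theorem stageEnergy_sub_le {L : ℝ≥0} (hf : LipschitzWith L f) (h0 : f 0 = 0)
    (hD : IsOutput f u₀ N y T D) (hN : 1 ≤ N) (hj : j ≤ D.m) {k : ℝ} (hk : 0 ≤ k)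
    {φ : ℝ × ℝ → ℝ} (hφ : ContDiff ℝ ∞ φ) (hs : HasCompactSupport φ)
    (hφ0 : ∀ z, ∀ t ∈ Icc (D.τ j) (D.τ (j + 1)), 0 ≤ φ (z, t)) :
    IntegrableOn (fun p : ℝ × ℝ => D.stageIntegrand f k φ j p.1 p.2)
      (univ ×ˢ Ioo (D.τ j) (D.τ (j + 1))) volume ∧
    D.stageEnergy k φ j (D.τ (j + 1)) - D.stageEnergy k φ j (D.τ j) ≤
      ∫ t in (D.τ j)..(D.τ (j + 1)), ∫ z, D.stageIntegrand f k φ j z t := by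
  obtain ⟨R₀, hRφ₀⟩ := exists_radius hφ hs
  -- `R` exceeds all particle positions of the stage and is at least the radius beyond which `φ`
  -- vanishes.
  obtain ⟨R, hRR, hR⟩ := hD.exists_confined hj R₀
  have hRφ := fun z t (h : R ≤ |z|) => hRφ₀ z t (hRR.trans h)
  have hab := (hD.time_lt j hj).le
  have hX : ∀ i ≤ D.n j + 1, IsPath (D.τ j) (D.τ (j + 1)) L (D.node R j i) :=
    fun i _ => isPath_node hf h0 hD hj i
  have hlt : ∀ t ∈ Ioo (D.τ j) (D.τ (j + 1)), ∀ i < D.n j + 1,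
      D.node R j i t < D.node R j (i + 1) t :=
    fun t ht i hi => hD.node_lt hN hj hR (Ioo_subset_Ico_self ht) hi
  have hF : ∀ t ∈ Ioo (D.τ j) (D.τ (j + 1)), ∀ i < D.n j + 1,
      ∀ z ∈ Ioo (D.node R j i t) (D.node R j (i + 1) t), D.stageIntegrand f k φ j z t =
        cellIntegrand k (f k) φ (D.cellMass j i) (D.node R j i) (D.node R j (i + 1)) z t :=
    fun t ht i hi z hz => hD.stageIntegrand_eq hN hj hR ht hi hz
  have hout : ∀ t ∈ Ioo (D.τ j) (D.τ (j + 1)), ∀ z,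
      z ∉ Ioo (D.node R j 0 t) (D.node R j (D.n j + 1) t) → D.stageIntegrand f k φ j z t = 0 := by
    intro t _ z hz
    rw [node_zero, node_last] at hz
    obtain ⟨-, h1, h2⟩ := hRφ z t (not_lt.1 fun h => hz (abs_lt.1 h))
    rw [stageIntegrand, h1, h2, mul_zero, mul_zero, add_zero]
  refine ⟨integrableOn_of_cells hφ hs hX hlt hF hout, ?_⟩
  rw [hD.stageEnergy_start hN hj hR hφ fun z t h => (hRφ z t h).1]
  refine (sub_le_sub_right (hD.stageEnergy_end_le hN hj hR hφ
    (fun z => hφ0 z _ (right_mem_Icc.2 hab)) fun z t h => (hRφ z t h).1) _).trans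
    (sum_cellEnergy_sub_le hab hφ hs hX hlt hF hout (fun t ht i hi => ?_) (fun t _ => ?_)
      fun t _ => ?_)
  · have ht' := Ioo_subset_Icc_self ht
    rw [← density_eq i ht', ← density_eq (i + 1) ht', nodeFlux,
      (hD.hasDerivAt_node hj ⟨by simp, hi⟩ ht).deriv, ← mul_assoc]
    exact mul_nonneg (sign_sub_sign_mul_nonneg hf h0 hk _ _) (hφ0 _ t ht')
  · rw [nodeFlux, node_zero, (hRφ (-R) t (by rw [abs_neg]; exact le_abs_self R)).1, mul_zero]
  · rw [nodeFlux, node_last, (hRφ R t (le_abs_self R)).1, mul_zero]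

/-- The deletion of collapsed cells does not change the approximate solution. -/
theorem stageApprox_succ (hD : IsOutput f u₀ N y T D) (hN : 1 ≤ N) (hj : j < D.m) (z : ℝ) :
    D.stageApprox (j + 1) z (D.τ (j + 1)) = D.stageApprox j z (D.τ (j + 1)) := by
  obtain ⟨π, hmono, himg, hx, hw⟩ := hD.restart j hj
  have hn := hD.n_pos hN hj.le
  have hn' := hD.n_pos hN (j := j + 1) hj
  have hsurv : ∀ i ∈ Icc 1 (D.n (j + 1)), π i ∈ D.survivors j := fun i hi =>
    himg ▸ mem_image_of_mem π hi
  have hlast : π (D.n (j + 1)) = D.n j := by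
    have hmem : D.n j ∈ D.survivors j := ⟨⟨hn, le_rfl⟩, Or.inl rfl⟩
    rw [← himg] at hmem
    obtain ⟨i, hi, hie⟩ := hmem
    refine le_antisymm (hsurv _ ⟨hn', le_rfl⟩).1.2 ?_
    rw [← hie]
    exact hmono.monotoneOn hi ⟨hn', le_rfl⟩ hi.2
  have hmem : ∀ i ∈ Ico 1 (D.n (j + 1)), π i ∈ Ico 1 (D.n j) := fun i hi => by
    refine ⟨(hsurv i ⟨hi.1, hi.2.le⟩).1.1, ?_⟩
    rw [← hlast]
    exact hmono ⟨hi.1, hi.2.le⟩ ⟨hn', le_rfl⟩ hi.2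
  -- Labels strictly between `π i` and `π (i + 1)` are deleted, hence each such particle coincides
  -- with its right neighbour. The cell to the right of particle `π i` therefore ends at particle `π
  -- (i + 1)`.
  have hnext : ∀ i ∈ Ico 1 (D.n (j + 1)),
      D.x j (π i + 1) (D.τ (j + 1)) = D.x j (π (i + 1)) (D.τ (j + 1)) := by
    intro i hi
    have hi1 : i ∈ Icc 1 (D.n (j + 1)) := ⟨hi.1, hi.2.le⟩
    have hi2 : i + 1 ∈ Icc 1 (D.n (j + 1)) := ⟨by simp, hi.2⟩
    have hup : ∀ l, π i + 1 ≤ l → l ≤ π (i + 1) →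
        D.x j (π i + 1) (D.τ (j + 1)) = D.x j l (D.τ (j + 1)) := by
      intro l hl
      induction l, hl using Nat.le_induction with
      | base => exact fun _ => rfl
      | succ l hl ih =>
        intro hl'
        rw [ih (by omega)]
        by_contra hne
        have hln : l ≤ D.n j := (Nat.le_of_succ_le hl').trans (hsurv _ hi2).1.2
        have hls : l ∈ D.survivors j := ⟨⟨by omega, hln⟩, Or.inr hne⟩
        rw [← himg] at hls
        obtain ⟨i', hi', rfl⟩ := hls
        have h1 := (hmono.lt_iff_lt hi1 hi').1 hl
        have h2 := (hmono.lt_iff_lt hi' hi2).1 hl'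
        omega
    exact hup _ (hmono hi1 hi2 (Nat.lt_succ_self i)) le_rfl
  unfold stageApprox
  refine Finset.sum_of_injOn π ?_ ?_ ?_ ?_
  · intro i hi l hl h
    simp only [Finset.coe_Ico] at hi hl
    exact hmono.injOn ⟨hi.1, hi.2.le⟩ ⟨hl.1, hl.2.le⟩ h
  · intro i hi
    simp only [Finset.coe_Ico] at hi ⊢
    exact hmem i hi
  -- A label missed by `π` belongs to a cell of length zero, whose open interval is empty.
  · intro l hl hnot
    have hl := Finset.mem_Ico.1 hl
    have hxl : D.x j l (D.τ (j + 1)) = D.x j (l + 1) (D.τ (j + 1)) := by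
      by_contra hne
      have hls : l ∈ D.survivors j := ⟨⟨hl.1, hl.2.le⟩, Or.inr hne⟩
      rw [← himg] at hls
      obtain ⟨i, hi, rfl⟩ := hls
      refine hnot ⟨i, ?_, rfl⟩
      simp only [Finset.coe_Ico]
      refine ⟨hi.1, lt_of_le_of_ne hi.2 fun h => ?_⟩
      rw [h, hlast] at hl
      exact lt_irrefl _ hl.2
    simp [hxl]
  · intro i hi
    have hi := Finset.mem_Ico.1 hi
    -- Restarted cells have positive length, so the length ratio in `density` is `1` at the restart
    -- time.
    have hord := hD.ordered (j + 1) hj _ (left_mem_Ico.2 (hD.time_lt (j + 1) hj)) i hi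
    have hdens : D.density (j + 1) i (D.τ (j + 1)) = D.density j (π i) (D.τ (j + 1)) := by
      rw [← hw i hi, density, if_pos hi, div_self (sub_pos.2 hord).ne', one_mul]
    rw [hdens, hx i ⟨hi.1, hi.2.le⟩, hx (i + 1) ⟨by simp, hi.2⟩, hnext i hi]

theorem stageEnergy_succ (hD : IsOutput f u₀ N y T D) (hN : 1 ≤ N) (hj : j < D.m) (k : ℝ)
    (φ : ℝ × ℝ → ℝ) :
    D.stageEnergy k φ (j + 1) (D.τ (j + 1)) = D.stageEnergy k φ j (D.τ (j + 1)) := by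
  simp only [stageEnergy, hD.stageApprox_succ hN hj]

theorem stageApprox_zero (hD : IsOutput f u₀ N y T D) (hy : StrictMonoOn y (Icc 1 N)) (z : ℝ) :
    D.stageApprox 0 z 0 = initialApprox u₀ N y z := by
  rw [stageApprox, initialApprox, hD.number_zero]
  refine Finset.sum_congr rfl fun i hi => ?_
  have hi := Finset.mem_Ico.1 hi
  have hi1 : i ∈ Icc 1 N := ⟨hi.1, hi.2.le⟩
  have hi2 : i + 1 ∈ Icc 1 N := ⟨by simp, hi.2⟩
  have hne : y (i + 1) - y i ≠ 0 := (sub_pos.2 (hy hi1 hi2 (Nat.lt_succ_self i))).ne'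
  rw [density, hD.number_zero, if_pos hi, hD.time_zero, hD.position_zero i hi1,
    hD.position_zero (i + 1) hi2, hD.density_zero i hi, div_self hne, one_mul]

theorem time_mono (hD : IsOutput f u₀ N y T D) {i l : ℕ} (h : i ≤ l) (hl : l ≤ D.m + 1) :
    D.τ i ≤ D.τ l :=
  nodes_le (fun i hi => (hD.time_lt i (Nat.lt_succ_iff.1 hi)).le) h hl

theorem stage_eq (hD : IsOutput f u₀ N y T D) (hj : j ≤ D.m) {t : ℝ}
    (ht : t ∈ Ico (D.τ j) (D.τ (j + 1))) : D.stage t = j := by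
  have : (Finset.Icc 1 D.m).filter (fun i => D.τ i ≤ t) = Finset.Icc 1 j := by
    ext i
    simp only [Finset.mem_filter, Finset.mem_Icc]
    constructor
    · rintro ⟨⟨h1, h2⟩, h3⟩
      refine ⟨h1, not_lt.1 fun h => ?_⟩
      exact absurd (ht.2.trans_le (hD.time_mono h (by omega))) (not_lt.2 h3)
    · rintro ⟨h1, h2⟩
      exact ⟨⟨h1, h2.trans hj⟩, (hD.time_mono h2 (by omega)).trans ht.1⟩
  rw [stage, this, Nat.card_Icc, Nat.add_sub_cancel]

theorem stage_last (hD : IsOutput f u₀ N y T D) : D.stage T = D.m := by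
  rw [stage, Finset.filter_true_of_mem, Nat.card_Icc, Nat.add_sub_cancel]
  intro i hi
  rw [← hD.time_last]
  exact hD.time_mono ((Finset.mem_Icc.1 hi).2.trans (Nat.le_succ _)) le_rfl

theorem entropyIntegrand_eq (hD : IsOutput f u₀ N y T D) (hj : j ≤ D.m) {t : ℝ}
    (ht : t ∈ Ico (D.τ j) (D.τ (j + 1))) (k : ℝ) (φ : ℝ × ℝ → ℝ) (z : ℝ) :
    entropyIntegrand f D k φ z t = D.stageIntegrand f k φ j z t := by
  have h := hD.stage_eq hj ht
  subst h
  rfl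

end IsOutput

end Run

/-! ### Assembling the stages. -/

theorem measure_snd_eq_const (r : ℝ) : volume {p : ℝ × ℝ | p.2 = r} = 0 := by
  have : {p : ℝ × ℝ | p.2 = r} = univ ×ˢ {r} := by
    ext p; exact ⟨fun h => ⟨mem_univ _, h⟩, fun h => h.2⟩
  rw [this, Measure.volume_eq_prod, Measure.prod_prod]
  simp

/-- Integrability on a time slab follows from integrability on finitely many adjacent open
slabs. -/
theorem integrableOn_slab {G : ℝ × ℝ → ℝ} {τ : ℕ → ℝ} {n : ℕ}
    (hG : ∀ j < n, IntegrableOn G (univ ×ˢ Ioo (τ j) (τ (j + 1))) volume) :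
    IntegrableOn G (univ ×ˢ Icc (τ 0) (τ n)) volume := by
  have hcov : (univ ×ˢ Icc (τ 0) (τ n) : Set (ℝ × ℝ)) ⊆
      (⋃ j ∈ Finset.range n, univ ×ˢ Ioo (τ j) (τ (j + 1)))
        ∪ ⋃ j ∈ Finset.range (n + 1), {p : ℝ × ℝ | p.2 = τ j} := by
    rintro ⟨z, t⟩ ⟨-, ht⟩
    by_cases hne : ∀ j ≤ n, t ≠ τ j
    · obtain ⟨j, hj, hjt⟩ := exists_mem_Ioo_of_ne (ξ := τ)
        ⟨lt_of_le_of_ne ht.1 (hne 0 (Nat.zero_le n)).symm, lt_of_le_of_ne ht.2 (hne n le_rfl)⟩ hne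
      exact Or.inl (mem_biUnion (Finset.mem_range.2 hj) ⟨mem_univ _, hjt⟩)
    · push Not at hne
      obtain ⟨j, hj, hjt⟩ := hne
      exact Or.inr (mem_biUnion (Finset.mem_range.2 (Nat.lt_succ_of_le hj)) hjt)
  refine IntegrableOn.mono_set (IntegrableOn.union ?_ ?_) hcov
  · rw [integrableOn_finset_iUnion]
    exact fun j hj => hG j (Finset.mem_range.1 hj)
  · rw [integrableOn_finset_iUnion]
    exact fun j _ => IntegrableOn.of_measure_zero (measure_snd_eq_const _)

end ParticlePath

end

theorem mainTheorem4
    (f : ℝ → ℝ) (L : ℝ≥0) (hf : LipschitzWith L f) (hf_zero : f 0 = 0)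
    (hf_diff : DifferentiableAt ℝ f 0)
    (u₀ : ℝ → ℝ) (hu_int : Integrable u₀ volume) (hu_nonneg : 0 ≤ᵐ[volume] u₀)
    (hu_bv : ParticlePath.IsBV u₀)
    (N : ℕ) (hN : 1 ≤ N) (y : ℕ → ℝ) (hy : StrictMonoOn y (Icc 1 N))
    (T : ℝ) (hT : 0 < T)
    (D : ParticlePath.Run) (hD : ParticlePath.Run.IsOutput f u₀ N y T D)
    (k : ℝ) (hk : 0 ≤ k)
    (φ : ℝ × ℝ → ℝ) (hφ : ContDiff ℝ ∞ φ) (hφ_supp : HasCompactSupport φ)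
    (hφ_nonneg : ∀ z : ℝ, ∀ t ∈ Icc 0 T, 0 ≤ φ (z, t)) :
    IntegrableOn (fun p : ℝ × ℝ => ParticlePath.entropyIntegrand f D k φ p.1 p.2)
      (univ ×ˢ Icc 0 T) volume ∧
    Integrable (fun z : ℝ => φ (z, T) * |D.approx z T - k|) volume ∧
    Integrable (fun z : ℝ => φ (z, 0) * |ParticlePath.initialApprox u₀ N y z - k|) volume ∧
    0 ≤ (∫ t in (0 : ℝ)..T, ∫ z, ParticlePath.entropyIntegrand f D k φ z t)
      - (∫ z, φ (z, T) * |D.approx z T - k|)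
      + ∫ z, φ (z, 0) * |ParticlePath.initialApprox u₀ N y z - k| := by
  have hsub : ∀ j ≤ D.m, Icc (D.τ j) (D.τ (j + 1)) ⊆ Icc 0 T := fun j hj => by
    rw [← hD.time_zero, ← hD.time_last]
    exact Icc_subset_Icc (hD.time_mono (Nat.zero_le j) (by omega))
      (hD.time_mono (by omega) le_rfl)
  have hstage := fun j (hj : j ≤ D.m) => ParticlePath.Run.IsOutput.stageEnergy_sub_le hf hf_zero
    hD hN hj hk hφ hφ_supp fun z t ht => hφ_nonneg z t (hsub j hj ht)
  have hint : ∀ j < D.m + 1, IntegrableOn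
      (fun p : ℝ × ℝ => ParticlePath.entropyIntegrand f D k φ p.1 p.2)
      (univ ×ˢ Ioo (D.τ j) (D.τ (j + 1))) volume := fun j hj =>
    (hstage j (Nat.lt_succ_iff.1 hj)).1.congr_fun (fun p hp => (hD.entropyIntegrand_eq
      (Nat.lt_succ_iff.1 hj) (Ioo_subset_Ico_self hp.2) k φ p.1).symm)
      (MeasurableSet.univ.prod measurableSet_Ioo)
  refine ⟨?_, ?_, ?_, ?_⟩
  · have := ParticlePath.integrableOn_slab hint
    rwa [hD.time_zero, hD.time_last] at this
  · exact ParticlePath.integrable_mul_abs_sum_indicator_sub hφ hφ_supp T k _ _ _ _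
  · exact ParticlePath.integrable_mul_abs_sum_indicator_sub hφ hφ_supp 0 k _ _ _ _
  have hslice : ∀ j < D.m + 1, IntervalIntegrable
      (fun t => ∫ z, ParticlePath.entropyIntegrand f D k φ z t) volume (D.τ j) (D.τ (j + 1)) := by
    intro j hj
    have h := hint j hj
    rw [IntegrableOn, Measure.volume_eq_prod, ← Measure.prod_restrict, Measure.restrict_univ] at h
    rw [intervalIntegrable_iff_integrableOn_Ioo_of_le (hD.time_lt j (Nat.lt_succ_iff.1 hj)).le]
    exact h.integral_prod_right
  have hsum := intervalIntegral.sum_integral_adjacent_intervals hslice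
  rw [hD.time_zero, hD.time_last] at hsum
  have hle : ∀ j ≤ D.m, D.stageEnergy k φ j (D.τ (j + 1)) - D.stageEnergy k φ j (D.τ j) ≤
      ∫ t in (D.τ j)..(D.τ (j + 1)), ∫ z, ParticlePath.entropyIntegrand f D k φ z t := by
    intro j hj
    refine (hstage j hj).2.trans (le_of_eq ?_)
    refine intervalIntegral.integral_congr_Ioo_of_le (hD.time_lt j hj).le fun t ht => ?_
    simp only [hD.entropyIntegrand_eq hj (Ioo_subset_Ico_self ht)]
  have htel : D.stageEnergy k φ D.m (D.τ (D.m + 1)) - D.stageEnergy k φ 0 (D.τ 0) ≤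
      ∑ j ∈ Finset.range (D.m + 1),
        ∫ t in (D.τ j)..(D.τ (j + 1)), ∫ z, ParticlePath.entropyIntegrand f D k φ z t := by
    have h1 : ∑ j ∈ Finset.range D.m,
        (D.stageEnergy k φ (j + 1) (D.τ (j + 1)) - D.stageEnergy k φ j (D.τ j)) ≤
        ∑ j ∈ Finset.range D.m,
          ∫ t in (D.τ j)..(D.τ (j + 1)), ∫ z, ParticlePath.entropyIntegrand f D k φ z t := by
      refine Finset.sum_le_sum fun j hj => ?_
      have hj := Finset.mem_range.1 hj
      -- The entropy does not jump at a restart, so the sum of the stage inequalities telescopes.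
      rw [hD.stageEnergy_succ hN hj]
      exact hle j hj.le
    rw [Finset.sum_range_sub fun j => D.stageEnergy k φ j (D.τ j)] at h1
    rw [Finset.sum_range_succ]
    linarith [hle D.m le_rfl]
  -- At `t = T` the solution is read off from stage `m` at its right end, even if particles meet
  -- there.
  have hend : D.stageEnergy k φ D.m (D.τ (D.m + 1)) = ∫ z, φ (z, T) * |D.approx z T - k| := by
    rw [hD.time_last, ← hD.stage_last]
    rfl
  have hstart : D.stageEnergy k φ 0 (D.τ 0) =
      ∫ z, φ (z, 0) * |ParticlePath.initialApprox u₀ N y z - k| := by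
    rw [hD.time_zero]
    simp only [ParticlePath.Run.stageEnergy, hD.stageApprox_zero hy]
  rw [hsum, hend, hstart] at htel
  linarith
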